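/- Let $u_0,v_0\in\mathcal S(\mathbb R)$ be real-valued Schwartz functions and $\omega=e^{2\pi i/3}$. For $k\in\mathbb C\setminus\{0\}$ and $j=1,2,3$ put $l_j(k)=i\,\frac{\omega^jk+(\omega^jk)^{-1}}{2\sqrt3}$, $\mathcal L=\mathrm{diag}(l_1,l_2,l_3)$, let $P(k)$ be the matrix with rows $(1,1,1)$, $(l_1,l_2,l_3)$, $(l_1^2,l_2^2,l_3^2)$, and $$\mathsf U(x,k)=P(k)^{-1}\begin{pmatrix}0&0&0\\0&0&0\\-\frac{u_0'(x)}4-\frac{iv_0(x)}{4\sqrt3}&-\frac{u_0(x)}2&0\end{pmatrix}P(k).$$ With $e^{a\hat{\mathcal L}}A=e^{a\mathcal L}Ae^{-a\mathcal L}$, let $X$, $X^A$ be the $3\times3$-matrix solutions (each column being the unique bounded continuous solution, for those $k$ for which the exponentials in that column are bounded) of $$X(x,k)=I-\int_x^\infty e^{(x-x')\hat{\mathcal L}(k)}(\mathsf UX)(x',k)\,dx',\qquad X^A(x,k)=I+\int_x^\infty e^{-(x-x')\hat{\mathcal L}(k)}(\mathsf U^TX^A)(x',k)\,dx',$$ and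 put $$s(k)=I-\int_{\mathbb R}e^{-x\hat{\mathcal L}(k)}(\mathsf UX)(x,k)\,dx,\qquad s^A(k)=I+\int_{\mathbb R}e^{x\hat{\mathcal L}(k)}(\mathsf U^TX^A)(x,k)\,dx .$$ Let $\mathcal Q=\{k:k^6=1\}$, $D_2=\{\mathrm{Re}\,l_1<\mathrm{Re}\,l_3<\mathrm{Re}\,l_2\}$, $D_5=\{\mathrm{Re}\,l_2<\mathrm{Re}\,l_3<\mathrm{Re}\,l_1\}$. Assume: (A1) $s_{11}\ne0$ on $\bar D_2\setminus(\mathcal Q\cup\{0\})$ and $s^A_{11}\neq 0$ on $\bar D_5\setminus(\mathcal Q\cup\{0\})$. (A2) For $\kappa=1$ and $\kappa=-1$, the following limits as $k\to\kappa$ along $\partial\mathbb D \setminus \mathcal Q$ are nonzero: those of $(k-\kappa)s_{11}$, $(k-\kappa)s_{13}$, $s_{31}$, $s_{33}$, $(k-\kappa)s^A_{11}$, $(k-\kappa)s^A_{31}$, $s^A_{13}$, $s^A_{33}$. On $\partial\mathbb D\setminus\mathcal Q$ define $r_1=s_{12}/s_{11}$ and $r_2=s^A_{12}/s^A_{11}$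 (a quotient with denominator $0$ being given the value $0$), and $$f(k)=1+r_1(k)r_2(k)+r_1\big(\tfrac1{\omega^2k}\big)r_2\big(\tfrac1{\omega^2k}\big).$$ Then $f$ has a limit along $\partial\mathbb D\setminus\mathcal Q$ at every point of $\mathcal Q$, and $r_1$, $r_2$ have limits along $\partial\mathbb D\setminus\mathcal Q$ at $\pm\omega$; let $f$, $r_1$, $r_2$ be extended to these points by these limits. Moreover $f(k)=1/|s_{11}(k)|^2$ for all $k\in\partial\mathbb D\setminus\mathcal Q$ with $s_{11}(k)\neq0$, and the following hold (an inequality for a complex quantity includes the assertion that it is real; $\arg k\in[0,2\pi)$): (i) (a) $f(k)\ge0$ for all $k\in\partial\mathbb D$; (b) for $k\in\partial\mathbb D$, $f(k)=0$ if and only if $k\in\{\pm1,\pm\omega\}$; (c) $f(k)\le1$ for all $k\in\partial\mathbb D$ with $\arg k\in(2\pi/3,\pi)\cup(5\pi/3,2\pi)$. (ii) $1+r_1(k)r_2(k)>0$ for all $k\in\partial\mathbb D$ with $\arg k\in(\pi/3,\pi)\cup(4\pi/3,2\pi)$. (iii) $-\frac1{2\pi}\ln(1+r_1(k)r_2(k))\ge0$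 for all $k\in\partial\mathbb D$ with $\arg k\in(5\pi/3,2\pi)$. (iv) Let $\nu_1(k)=-\frac1{2\pi}\ln(1+r_1(\omega k)r_2(\omega k))$, $\nu_2(k)=-\frac1{2\pi}\ln(1+r_1(\omega^2k)r_2(\omega^2k))$, $\nu_3(k)=-\frac1{2\pi}\ln f(\omega k)$, $\nu_4(k)=-\frac1{2\pi}\ln f(\omega^2k)$, and $\hat\nu_1=\nu_3-\nu_1$, $\hat\nu_2=\nu_2+\nu_3-\nu_4$. Then $\hat\nu_1(k)\ge0$ for all $k\in\partial\mathbb D$ with $\arg k\in(5\pi/3,2\pi)$, and $\hat\nu_2(k)\ge0$ for all $k\in\partial\mathbb D$ with $\arg k\in(\pi,4\pi/3)$. -/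

import Mathlib

open scoped ComplexOrder

noncomputable section

namespace Boussinesq

open Filter Topology MeasureTheory

/-- The primitive cube root of unity `exp (2πi/3)`. -/
def om : ℂ := Complex.exp (2 * Real.pi * Complex.I / 3)

/-- The functions `l_j(k) = i (ω^j k + (ω^j k)⁻¹) / (2√3)`, `j = 1, 2, 3`.
The index `j : Fin 3` stands for `j + 1`, here and for all matrix entries below. -/
def ell (j : Fin 3) (k : ℂ) : ℂ :=
  Complex.I * (om ^ ((j : ℕ) + 1) * k + (om ^ ((j : ℕ) + 1) * k)⁻¹) / (2 * (Real.sqrt 3 : ℂ))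

/-- The matrix `P(k)`, with rows `1`, `l_j(k)`, `l_j(k)^2`. -/
def Pmat (k : ℂ) : Matrix (Fin 3) (Fin 3) ℂ :=
  Matrix.of fun i j => ell j k ^ (i : ℕ)

/-- The potential matrix, before conjugation by `P(k)`. -/
def Wmat (u₀ v₀ : SchwartzMap ℝ ℝ) (x : ℝ) : Matrix (Fin 3) (Fin 3) ℂ :=
  !![0, 0, 0;
     0, 0, 0;
     -((deriv u₀ x : ℝ) : ℂ) / 4 - Complex.I * ((v₀ x : ℝ) : ℂ) / (4 * (Real.sqrt 3 : ℂ)),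
       -((u₀ x : ℝ) : ℂ) / 2, 0]

/-- `U(x,k) = P(k)⁻¹ W(x) P(k)`. -/
def Umat (u₀ v₀ : SchwartzMap ℝ ℝ) (x : ℝ) (k : ℂ) : Matrix (Fin 3) (Fin 3) ℂ :=
  (Pmat k)⁻¹ * Wmat u₀ v₀ x * Pmat k

/-- `Y` is the `j`-th column of `X(·,k)`: a bounded continuous solution of the `j`-th column of
`X(x,k) = I - ∫_x^∞ e^{(x-x') ad L(k)} (U X)(x',k) dx'`, where `L = diag(l₁,l₂,l₃)`, so that
`(e^{(x-x') ad L} A)_{ij} = e^{(x-x')(l_i - l_j)} A_{ij}`. -/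
def IsXColumn (u₀ v₀ : SchwartzMap ℝ ℝ) (k : ℂ) (j : Fin 3) (Y : ℝ → Fin 3 → ℂ) : Prop :=
  Continuous Y ∧ (∃ C : ℝ, ∀ x, ‖Y x‖ ≤ C) ∧
    ∀ x i, Y x i = (1 : Matrix (Fin 3) (Fin 3) ℂ) i j -
      ∫ y in Set.Ioi x, Complex.exp (((x - y : ℝ) : ℂ) * (ell i k - ell j k)) *
        (Umat u₀ v₀ y k).mulVec (Y y) i

/-- `Y` is the `j`-th column of `X^A(·,k)`: a bounded continuous solution of the `j`-th column of
`X^A(x,k) = I + ∫_x^∞ e^{-(x-x') ad L(k)} (Uᵀ X^A)(x',k) dx'`. -/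
def IsXAColumn (u₀ v₀ : SchwartzMap ℝ ℝ) (k : ℂ) (j : Fin 3) (Y : ℝ → Fin 3 → ℂ) : Prop :=
  Continuous Y ∧ (∃ C : ℝ, ∀ x, ‖Y x‖ ≤ C) ∧
    ∀ x i, Y x i = (1 : Matrix (Fin 3) (Fin 3) ℂ) i j +
      ∫ y in Set.Ioi x, Complex.exp (-((x - y : ℝ) : ℂ) * (ell i k - ell j k)) *
        (Umat u₀ v₀ y k).transpose.mulVec (Y y) i

/-- The eigenfunction `X(x,k)`. Each column is the solution of its own Volterra equation, which
exists and is unique for `k` in a domain that depends on the column and that contains the unit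
circle without the sixth roots of unity; it is used only there. -/
def X (u₀ v₀ : SchwartzMap ℝ ℝ) (x : ℝ) (k : ℂ) : Matrix (Fin 3) (Fin 3) ℂ :=
  Matrix.of fun i j => Classical.epsilon (IsXColumn u₀ v₀ k j) x i

/-- The eigenfunction `X^A(x,k)`, column by column as for `X`. -/
def XA (u₀ v₀ : SchwartzMap ℝ ℝ) (x : ℝ) (k : ℂ) : Matrix (Fin 3) (Fin 3) ℂ :=
  Matrix.of fun i j => Classical.epsilon (IsXAColumn u₀ v₀ k j) x i

/-- `s(k) = I - ∫_ℝ e^{-x ad L(k)} (U X)(x,k) dx`, entry by entry. -/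
def s (u₀ v₀ : SchwartzMap ℝ ℝ) (k : ℂ) : Matrix (Fin 3) (Fin 3) ℂ :=
  Matrix.of fun i j => (1 : Matrix (Fin 3) (Fin 3) ℂ) i j -
    ∫ x : ℝ, Complex.exp (-(x : ℂ) * (ell i k - ell j k)) *
      (Umat u₀ v₀ x k * X u₀ v₀ x k) i j

/-- `s^A(k) = I + ∫_ℝ e^{x ad L(k)} (Uᵀ X^A)(x,k) dx`, entry by entry. -/
def sA (u₀ v₀ : SchwartzMap ℝ ℝ) (k : ℂ) : Matrix (Fin 3) (Fin 3) ℂ :=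
  Matrix.of fun i j => (1 : Matrix (Fin 3) (Fin 3) ℂ) i j +
    ∫ x : ℝ, Complex.exp ((x : ℂ) * (ell i k - ell j k)) *
      ((Umat u₀ v₀ x k).transpose * XA u₀ v₀ x k) i j

/-- The unit circle `∂𝔻`. -/
def circle : Set ℂ := Metric.sphere 0 1

/-- The open arc of all `e^{iθ}` with `a < θ < b`. -/
def arc (a b : ℝ) : Set ℂ := {k | ∃ θ ∈ Set.Ioo a b, k = Complex.exp ((θ : ℂ) * Complex.I)}

/-- The sixth roots of unity. -/
def Q : Set ℂ := {k | k ^ 6 = 1}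

/-- `D₂ = {Re l₁ < Re l₃ < Re l₂}`. -/
def D2 : Set ℂ := {k | (ell 0 k).re < (ell 2 k).re ∧ (ell 2 k).re < (ell 1 k).re}

/-- `D₅ = {Re l₂ < Re l₃ < Re l₁}`. -/
def D5 : Set ℂ := {k | (ell 1 k).re < (ell 2 k).re ∧ (ell 2 k).re < (ell 0 k).re}

/-- Absence of solitons: `s₁₁` has no zeros in the closure of `D₂`, and `s^A₁₁` has none in the
closure of `D₅`, the sixth roots of unity and `0` being left out. -/
def NoSolitons (u₀ v₀ : SchwartzMap ℝ ℝ) : Prop :=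
  (∀ k ∈ closure D2 \ insert 0 Q, s u₀ v₀ k 0 0 ≠ 0) ∧
  (∀ k ∈ closure D5 \ insert 0 Q, sA u₀ v₀ k 0 0 ≠ 0)

/-- `lim_{k → κ} g(k) ≠ 0`, the limit being along the unit circle, on which all entries of `s` and
`s^A` are defined. -/
def LimNeZero (g : ℂ → ℂ) (κ : ℂ) : Prop :=
  ∃ c : ℂ, c ≠ 0 ∧ Tendsto g (𝓝[circle \ Q] κ) (𝓝 c)

/-- Generic behavior of `s` and `s^A` at the point `κ` (used for `κ = 1` and `κ = -1`). -/
def GenericAt (u₀ v₀ : SchwartzMap ℝ ℝ) (κ : ℂ) : Prop :=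
  LimNeZero (fun k => (k - κ) * s u₀ v₀ k 0 0) κ ∧
  LimNeZero (fun k => (k - κ) * s u₀ v₀ k 0 2) κ ∧
  LimNeZero (fun k => s u₀ v₀ k 2 0) κ ∧
  LimNeZero (fun k => s u₀ v₀ k 2 2) κ ∧
  LimNeZero (fun k => (k - κ) * sA u₀ v₀ k 0 0) κ ∧
  LimNeZero (fun k => (k - κ) * sA u₀ v₀ k 2 0) κ ∧
  LimNeZero (fun k => sA u₀ v₀ k 0 2) κ ∧
  LimNeZero (fun k => sA u₀ v₀ k 2 2) κ

open Classical in
/-- The extension of a function on `∂𝔻 \ Q` to the points of `Q` by its limits along `∂𝔻 \ Q`. -/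
def circleExt (g : ℂ → ℂ) (k : ℂ) : ℂ :=
  if k ∈ Q then limUnder (𝓝[circle \ Q] k) g else g k

/-- `s₁₂ / s₁₁`, without the extension to `Q`. -/
def r1Raw (u₀ v₀ : SchwartzMap ℝ ℝ) (k : ℂ) : ℂ := s u₀ v₀ k 0 1 / s u₀ v₀ k 0 0

/-- `s^A₁₂ / s^A₁₁`, without the extension to `Q`. -/
def r2Raw (u₀ v₀ : SchwartzMap ℝ ℝ) (k : ℂ) : ℂ := sA u₀ v₀ k 0 1 / sA u₀ v₀ k 0 0

/-- The reflection coefficient `r₁` on the unit circle. -/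
def r1 (u₀ v₀ : SchwartzMap ℝ ℝ) : ℂ → ℂ := circleExt (r1Raw u₀ v₀)

/-- The reflection coefficient `r₂` on the unit circle (with poles at `±ω²`). -/
def r2 (u₀ v₀ : SchwartzMap ℝ ℝ) : ℂ → ℂ := circleExt (r2Raw u₀ v₀)

/-- The expression `1 + r₁(k) r₂(k) + r₁(1/(ω²k)) r₂(1/(ω²k))`. -/
def fRaw (u₀ v₀ : SchwartzMap ℝ ℝ) (k : ℂ) : ℂ :=
  1 + r1 u₀ v₀ k * r2 u₀ v₀ k +
    r1 u₀ v₀ (1 / (om ^ 2 * k)) * r2 u₀ v₀ (1 / (om ^ 2 * k))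

/-- The function `f : ∂𝔻 → ℂ`. At the sixth roots of unity it is the limit of `fRaw` (at `±ω²` the
poles of the two terms of `fRaw` cancel). -/
def f (u₀ v₀ : SchwartzMap ℝ ℝ) : ℂ → ℂ := circleExt (fRaw u₀ v₀)

/-- `z ↦ -(1/2π) ln z`, with the principal logarithm. -/
def nuLog (z : ℂ) : ℂ := -(1 / (2 * (Real.pi : ℂ))) * Complex.log z

/-- `ν₁(k) = -(1/2π) ln (1 + r₁(ωk) r₂(ωk))`. -/
def nu1 (u₀ v₀ : SchwartzMap ℝ ℝ) (k : ℂ) : ℂ :=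
  nuLog (1 + r1 u₀ v₀ (om * k) * r2 u₀ v₀ (om * k))

/-- `ν₂(k) = -(1/2π) ln (1 + r₁(ω²k) r₂(ω²k))`. -/
def nu2 (u₀ v₀ : SchwartzMap ℝ ℝ) (k : ℂ) : ℂ :=
  nuLog (1 + r1 u₀ v₀ (om ^ 2 * k) * r2 u₀ v₀ (om ^ 2 * k))

/-- `ν₃(k) = -(1/2π) ln f(ωk)`. -/
def nu3 (u₀ v₀ : SchwartzMap ℝ ℝ) (k : ℂ) : ℂ := nuLog (f u₀ v₀ (om * k))

/-- `ν₄(k) = -(1/2π) ln f(ω²k)`. -/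
def nu4 (u₀ v₀ : SchwartzMap ℝ ℝ) (k : ℂ) : ℂ := nuLog (f u₀ v₀ (om ^ 2 * k))

/-- `ν̂₁ = ν₃ - ν₁`. -/
def nuHat1 (u₀ v₀ : SchwartzMap ℝ ℝ) (k : ℂ) : ℂ := nu3 u₀ v₀ k - nu1 u₀ v₀ k

/-- `ν̂₂ = ν₂ + ν₃ - ν₄`. -/
def nuHat2 (u₀ v₀ : SchwartzMap ℝ ℝ) (k : ℂ) : ℂ :=
  nu2 u₀ v₀ k + nu3 u₀ v₀ k - nu4 u₀ v₀ k

end Boussinesq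

end

noncomputable section

namespace Boussinesq

open Filter Topology MeasureTheory

/-! On the unit circle without the sixth roots of unity the exponents l_j are distinct and purely
imaginary. After removal of unimodular factors, the columns of X therefore solve a linear system Z'
= VZ with integrable V; they tend to the basis vectors at +∞ and to the columns of s at −∞. The
columns of X^A and s^A play the same roles for the dual system Z' = −VᵀZ. Everything rests on two
conserved pairings.

The bilinear pairing of the two systems is constant, so (s^A)ᵀ s = I (`transpose_sA_mul_s`). Since
u₀ and v₀ are real, there is also a conserved Hermitian form: ∑ d_j |Z_j|² plus a correction
(u₀/2)|φ|² that vanishes at infinity, where d_j = ∏_{m≠j} (l_j − l_m) is real. Hence s* D s = D for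
D = diag(d_j) (`conjTranspose_s_mul_diagonal_mul_s`). Together they give s^A_ij = (d_i/d_j)
conj(s_ij), so that r₁r₂ = (d₁/d₂)|s₁₂/s₁₁|². The involution k ↦ ω/k = 1/(ω²k) exchanges l₂ and l₃,
so the other product in f is (d₁/d₃)|s₁₃/s₁₁|², and the first row of s D⁻¹ s* = D⁻¹ sums f to
1/|s₁₁|² (`fReal_eq`).

The inequalities now follow from the signs of the d_j: d_j > 0 exactly when l_j lies between the
other two. Where l₁ is in the middle, both products are nonpositive and 0 < f ≤ 1 + r₁r₂ ≤ 1. Where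
l₃ is, the first is nonnegative and the second nonpositive, so 1 + r₁r₂ ≥ 1 and f ≤ 1 + r₁r₂. The
bound for ν̂₂ also needs the third column of s* D s = D and the rotation s₁₁(ω²k) = s₃₃(k)
(`wReal_mul_fReal_le`).

At ±1 the pole of s₁₁ forces f → 0; the involution carries this to ±ω. At ±ω² the rotation turns f
into 1/|s₃₃|² at ±1, which has a positive limit. -/

/-! ### Volterra equations on the line -/

theorem integrable_of_le_inv_one_add_sq {E : Type*} [NormedAddCommGroup E] {g : ℝ → E} (hc : Continuous g) {C : ℝ}
    (hg : ∀ y, ‖g y‖ ≤ C * (1 + y ^ 2)⁻¹) : Integrable g :=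
  (integrable_inv_one_add_sq.const_mul C).mono' hc.aestronglyMeasurable
    (Eventually.of_forall hg)

theorem hasDerivAt_integral_Ioi {E : Type*} [NormedAddCommGroup E] [NormedSpace ℝ E]
    [CompleteSpace E] {g : ℝ → E} (hc : Continuous g) (hi : Integrable g) (x : ℝ) :
    HasDerivAt (fun x => ∫ y in Set.Ioi x, g y) (-g x) x := by
  have h : (fun x => ∫ y in Set.Ioi x, g y) =
      fun x => (∫ y in Set.Ioi (0 : ℝ), g y) - ∫ y in (0 : ℝ)..x, g y := by
    ext x
    rw [← intervalIntegral.integral_Ioi_sub_Ioi' hi.integrableOn hi.integrableOn]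
    abel
  rw [h]
  exact (hc.integral_hasStrictDerivAt 0 x).hasDerivAt.const_sub _

theorem tendsto_integral_Ioi_atBot {E : Type*} [NormedAddCommGroup E] [NormedSpace ℝ E]
    {g : ℝ → E} (hi : Integrable g) :
    Tendsto (fun x => ∫ y in Set.Ioi x, g y) atBot (𝓝 (∫ y, g y)) :=
  (aecover_Ioi tendsto_id).integral_tendsto_of_countably_generated hi

/-- The integrand is an exact derivative. The factor 1/2 on the right is the contraction constant of
the weighted Volterra operator below. -/
theorem integral_Ioi_exp_arctan (C x : ℝ) :
    IntegrableOn (fun y => C * (1 + y ^ 2)⁻¹ * Real.exp (-2 * C * Real.arctan y)) (Set.Ioi x) ∧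
    ∫ y in Set.Ioi x, C * (1 + y ^ 2)⁻¹ * Real.exp (-2 * C * Real.arctan y) =
      (Real.exp (-2 * C * Real.arctan x) - Real.exp (-2 * C * (Real.pi / 2))) / 2 := by
  have hint : Integrable fun y : ℝ =>
      C * (1 + y ^ 2)⁻¹ * Real.exp (-2 * C * Real.arctan y) := by
    refine (integrable_inv_one_add_sq.const_mul C).mul_bdd (c := Real.exp (2 * |C| * Real.pi))
      (by fun_prop) (Eventually.of_forall fun y => ?_)
    rw [Real.norm_eq_abs, Real.abs_exp, Real.exp_le_exp]
    have h1 := Real.arctan_lt_pi_div_two y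
    have h2 := Real.neg_pi_div_two_lt_arctan y
    have h3 : |Real.arctan y| ≤ Real.pi := abs_le.2 ⟨by linarith, by linarith⟩
    calc -2 * C * Real.arctan y ≤ |-2 * C * Real.arctan y| := le_abs_self _
      _ = 2 * |C| * |Real.arctan y| := by simp [abs_mul]
      _ ≤ _ := by gcongr
  refine ⟨hint.integrableOn, ?_⟩
  have hd : ∀ y ∈ Set.Ici x, HasDerivAt (fun y => -(1 / 2) * Real.exp (-2 * C * Real.arctan y))
      (C * (1 + y ^ 2)⁻¹ * Real.exp (-2 * C * Real.arctan y)) y := by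
    intro y _
    have := (((Real.hasDerivAt_arctan y).const_mul (-2 * C)).exp).const_mul (-(1 / 2) : ℝ)
    exact this.congr_deriv (by ring)
  have ht : Tendsto (fun y => -(1 / 2) * Real.exp (-2 * C * Real.arctan y)) atTop
      (𝓝 (-(1 / 2) * Real.exp (-2 * C * (Real.pi / 2)))) :=
    (((Real.tendsto_arctan_atTop.mono_right nhdsWithin_le_nhds).const_mul
      (-2 * C)).rexp).const_mul _
  rw [integral_Ioi_of_hasDerivAt_of_tendsto' hd hint.integrableOn ht]
  ring

/-- Unique solvability, among bounded continuous functions, of Volterra equations on the line whose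
kernel does not depend on the outer variable. -/
theorem existsUnique_volterra {E : Type*} [NormedAddCommGroup E] [NormedSpace ℝ E]
    [CompleteSpace E] (F : ℝ → E → E) (hF : Continuous (Function.uncurry F)) {C : ℝ}
    (hC : 0 ≤ C) (hF0 : ∀ y, F y 0 = 0)
    (hL : ∀ y z w, ‖F y z - F y w‖ ≤ C * (1 + y ^ 2)⁻¹ * ‖z - w‖) (v : E) :
    ∃! Y : ℝ → E, Continuous Y ∧ (∃ B : ℝ, ∀ x, ‖Y x‖ ≤ B) ∧
      ∀ x, Y x = v - ∫ y in Set.Ioi x, F y (Y y) := by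
  -- Weight adapted to the Lipschitz constant of the kernel: the integral of C(1 + y²)⁻¹ m(y) over
  -- (x, ∞) is at most m(x)/2. The unknown is written Y = mZ, which makes the equation a contraction
  -- for the plain sup norm of Z. As m and 1/m are bounded by `b`, boundedness of Y and of Z are
  -- equivalent.
  set m : ℝ → ℝ := fun x => Real.exp (-2 * C * Real.arctan x) with hm
  have hmc : Continuous m := by fun_prop
  have hmpos : ∀ x, 0 < m x := fun x => Real.exp_pos _
  obtain ⟨b, hb1, hmb, hmb'⟩ : ∃ b : ℝ, 0 < b ∧ (∀ x, m x ≤ b) ∧ ∀ x, (m x)⁻¹ ≤ b := by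
    refine ⟨Real.exp (C * Real.pi), Real.exp_pos _, fun x => ?_, fun x => ?_⟩
    · rw [hm, Real.exp_le_exp]
      nlinarith [Real.neg_pi_div_two_lt_arctan x]
    · rw [hm, ← Real.exp_neg, Real.exp_le_exp]
      nlinarith [Real.arctan_lt_pi_div_two x]
  have hFc : ∀ Z : ℝ → E, Continuous Z → Continuous fun y => F y (Z y) := fun Z hZ =>
    hF.comp (continuous_id.prodMk hZ)
  have hFb : ∀ Z : ℝ → E, ∀ B : ℝ, (∀ x, ‖Z x‖ ≤ B) → ∀ y, ‖F y (Z y)‖ ≤ (C * B) * (1 + y ^ 2)⁻¹ := by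
    intro Z B hB y
    have := hL y (Z y) 0
    rw [hF0, sub_zero, sub_zero] at this
    have h2 : 0 ≤ (1 + y ^ 2)⁻¹ := by positivity
    calc ‖F y (Z y)‖ ≤ C * (1 + y ^ 2)⁻¹ * ‖Z y‖ := this
      _ ≤ C * (1 + y ^ 2)⁻¹ * B := by gcongr; exact hB y
      _ = _ := by ring
  have hFi : ∀ Z : ℝ → E, Continuous Z → ∀ B : ℝ, (∀ x, ‖Z x‖ ≤ B) →
      Integrable fun y => F y (Z y) := fun Z hZ B hB =>
    integrable_of_le_inv_one_add_sq (hFc Z hZ) (hFb Z B hB)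
  have hscb : ∀ Z : BoundedContinuousFunction ℝ E, ∀ x, ‖m x • Z x‖ ≤ b * ‖Z‖ := by
    intro Z x
    rw [norm_smul, Real.norm_of_nonneg (hmpos x).le]
    exact mul_le_mul (hmb x) (Z.norm_coe_le_norm x) (norm_nonneg _) hb1.le
  have hscc : ∀ Z : BoundedContinuousFunction ℝ E, Continuous fun x => m x • Z x := fun Z =>
    hmc.smul Z.continuous
  have hTc : ∀ Z : BoundedContinuousFunction ℝ E,
      Continuous fun x => (m x)⁻¹ • (v - ∫ y in Set.Ioi x, F y (m y • Z y)) := by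
    intro Z
    refine (hmc.inv₀ fun x => (hmpos x).ne').smul (continuous_const.sub ?_)
    exact continuous_iff_continuousAt.2 fun x => (hasDerivAt_integral_Ioi (hFc _ (hscc Z))
      (hFi _ (hscc Z) _ (hscb Z)) x).continuousAt
  have hTb : ∀ Z : BoundedContinuousFunction ℝ E, ∀ x,
      ‖(m x)⁻¹ • (v - ∫ y in Set.Ioi x, F y (m y • Z y))‖ ≤
        b * (‖v‖ + ∫ y, ‖F y (m y • Z y)‖) := by
    intro Z x
    rw [norm_smul, Real.norm_of_nonneg (inv_nonneg.2 (hmpos x).le)]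
    refine mul_le_mul (hmb' x) ((norm_sub_le _ _).trans ?_) (norm_nonneg _) hb1.le
    gcongr
    exact (norm_integral_le_integral_norm _).trans
      (setIntegral_le_integral (hFi _ (hscc Z) _ (hscb Z)).norm
        (Eventually.of_forall fun _ => norm_nonneg _))
  let T : BoundedContinuousFunction ℝ E → BoundedContinuousFunction ℝ E := fun Z =>
    BoundedContinuousFunction.ofNormedAddCommGroup _ (hTc Z) _ (hTb Z)
  have hT : ContractingWith (1 / 2 : NNReal) T := by
    refine ⟨by rw [← NNReal.coe_lt_coe]; norm_num, LipschitzWith.of_dist_le_mul fun Z W => ?_⟩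
    refine (BoundedContinuousFunction.dist_le (by positivity)).2 fun x => ?_
    obtain ⟨hi, he⟩ := integral_Ioi_exp_arctan C x
    have h1 : ‖(∫ y in Set.Ioi x, F y (m y • W y)) - ∫ y in Set.Ioi x, F y (m y • Z y)‖ ≤
        (m x / 2) * dist Z W := by
      rw [← integral_sub (hFi _ (hscc W) _ (hscb W)).integrableOn
        (hFi _ (hscc Z) _ (hscb Z)).integrableOn]
      calc _ ≤ ∫ y in Set.Ioi x, C * (1 + y ^ 2)⁻¹ * m y * dist Z W := by
            refine norm_integral_le_of_norm_le (hi.mul_const _) (Eventually.of_forall fun y => ?_)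
            refine (hL y _ _).trans ?_
            rw [← smul_sub, norm_smul, Real.norm_of_nonneg (hmpos y).le, ← mul_assoc,
              ← dist_eq_norm, dist_comm (W y)]
            have h2 : 0 ≤ (1 + y ^ 2)⁻¹ := by positivity
            have := hmpos y
            gcongr
            exact BoundedContinuousFunction.dist_coe_le_dist y
        _ ≤ _ := by
            rw [integral_mul_const, he]
            gcongr
            linarith [Real.exp_pos (-2 * C * (Real.pi / 2))]
    change dist ((m x)⁻¹ • (v - ∫ y in Set.Ioi x, F y (m y • Z y)))
      ((m x)⁻¹ • (v - ∫ y in Set.Ioi x, F y (m y • W y))) ≤ _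
    rw [dist_eq_norm, ← smul_sub, sub_sub_sub_cancel_left, norm_smul,
      Real.norm_of_nonneg (inv_nonneg.2 (hmpos x).le)]
    calc _ ≤ (m x)⁻¹ * ((m x / 2) * dist Z W) := by
          gcongr
      _ = _ := by
          have := (hmpos x).ne'
          push_cast
          field_simp
  refine ⟨fun x => m x • hT.fixedPoint T x, ⟨hscc _, ⟨_, hscb _⟩, fun x => ?_⟩, ?_⟩
  · calc m x • hT.fixedPoint T x = m x • T (hT.fixedPoint T) x := by
          rw [hT.fixedPoint_isFixedPt.eq]
      _ = _ := smul_inv_smul₀ (hmpos x).ne' _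
  · rintro Y ⟨hYc, ⟨B, hB⟩, hY⟩
    let Z : BoundedContinuousFunction ℝ E := BoundedContinuousFunction.ofNormedAddCommGroup
      (fun x => (m x)⁻¹ • Y x) ((hmc.inv₀ fun x => (hmpos x).ne').smul hYc) (b * B) fun x => by
        rw [norm_smul, Real.norm_of_nonneg (inv_nonneg.2 (hmpos x).le)]
        exact mul_le_mul (hmb' x) (hB x) (norm_nonneg _) hb1.le
    have hmZ : ∀ x, m x • Z x = Y x := fun x => smul_inv_smul₀ (hmpos x).ne' _
    have hZ : Function.IsFixedPt T Z := by
      ext1 x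
      change (m x)⁻¹ • (v - ∫ y in Set.Ioi x, F y (m y • Z y)) = (m x)⁻¹ • Y x
      simp only [hmZ]
      rw [hY x]
    rw [← hT.fixedPoint_unique hZ]
    ext1 x
    exact (hmZ x).symm

/-! ### Jost solutions of linear systems with decaying potential -/

/-- Continuous matrix potentials with quadratic decay. -/
structure IsDecaying (V : ℝ → Matrix (Fin 3) (Fin 3) ℂ) : Prop where
  continuous : Continuous V
  decay : ∃ C : ℝ, 0 ≤ C ∧ ∀ y i j, ‖V y i j‖ ≤ C * (1 + y ^ 2)⁻¹

/-- Bounded continuous solutions of `Z' = V Z` with limit `v` at `+∞`, in integral form. -/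
def IsJost (V : ℝ → Matrix (Fin 3) (Fin 3) ℂ) (v : Fin 3 → ℂ) (Z : ℝ → Fin 3 → ℂ) : Prop :=
  Continuous Z ∧ (∃ B : ℝ, ∀ x, ‖Z x‖ ≤ B) ∧
    ∀ x i, Z x i = v i - ∫ y in Set.Ioi x, (V y).mulVec (Z y) i

theorem norm_mulVec_le {M : Matrix (Fin 3) (Fin 3) ℂ} {c : ℝ} (hc : 0 ≤ c)
    (hM : ∀ i j, ‖M i j‖ ≤ c) (z : Fin 3 → ℂ) : ‖M.mulVec z‖ ≤ 3 * c * ‖z‖ := by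
  refine (pi_norm_le_iff_of_nonneg (by positivity)).2 fun i => ?_
  calc ‖∑ j, M i j * z j‖ ≤ ∑ j, ‖M i j * z j‖ := norm_sum_le _ _
    _ ≤ ∑ _j : Fin 3, c * ‖z‖ := by
        refine Finset.sum_le_sum fun j _ => ?_
        rw [norm_mul]
        exact mul_le_mul (hM i j) (norm_le_pi_norm z j) (norm_nonneg _) hc
    _ = _ := by simp; ring

namespace IsDecaying

variable {V : ℝ → Matrix (Fin 3) (Fin 3) ℂ}

theorem neg_transpose (hV : IsDecaying V) : IsDecaying fun y => -(V y).transpose := by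
  refine ⟨hV.continuous.matrix_transpose.neg, ?_⟩
  obtain ⟨C, hC, h⟩ := hV.decay
  exact ⟨C, hC, fun y i j => by simpa using h y j i⟩

theorem continuous_mulVec (hV : IsDecaying V) {Z : ℝ → Fin 3 → ℂ} (hZ : Continuous Z) :
    Continuous fun y => (V y).mulVec (Z y) :=
  hV.continuous.matrix_mulVec hZ

theorem integrable_mulVec (hV : IsDecaying V) {Z : ℝ → Fin 3 → ℂ} (hZ : Continuous Z) {B : ℝ}
    (hB : ∀ x, ‖Z x‖ ≤ B) : Integrable fun y => (V y).mulVec (Z y) := by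
  obtain ⟨C, hC, h⟩ := hV.decay
  refine integrable_of_le_inv_one_add_sq (C := 3 * C * B) (hV.continuous_mulVec hZ) fun y => ?_
  have h2 : 0 ≤ (1 + y ^ 2)⁻¹ := by positivity
  calc _ ≤ 3 * (C * (1 + y ^ 2)⁻¹) * ‖Z y‖ := norm_mulVec_le (by positivity) (h y) _
    _ ≤ 3 * (C * (1 + y ^ 2)⁻¹) * B := by gcongr; exact hB y
    _ = _ := by ring

theorem existsUnique_isJost (hV : IsDecaying V) (v : Fin 3 → ℂ) : ∃! Z, IsJost V v Z := by
  obtain ⟨C, hC, h⟩ := hV.decay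
  have key := existsUnique_volterra (fun y z => (V y).mulVec z)
    ((hV.continuous.comp continuous_fst).matrix_mulVec continuous_snd)
    (C := 3 * C) (by positivity) (fun y => Matrix.mulVec_zero _) (fun y z w => by
      have h2 : 0 ≤ (1 + y ^ 2)⁻¹ := by positivity
      rw [← Matrix.mulVec_sub]
      exact (norm_mulVec_le (by positivity) (h y) _).trans (by rw [← mul_assoc])) v
  refine (existsUnique_congr fun Z => ?_).1 key
  refine and_congr_right fun hZ => and_congr_right fun ⟨B, hB⟩ => forall_congr' fun x => ?_
  have hi := hV.integrable_mulVec hZ hB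
  rw [funext_iff]
  refine forall_congr' fun i => ?_
  rw [Pi.sub_apply, eval_integral fun i => (hi.eval i).integrableOn]

end IsDecaying

namespace IsJost

variable {V : ℝ → Matrix (Fin 3) (Fin 3) ℂ} {v : Fin 3 → ℂ} {Z : ℝ → Fin 3 → ℂ}

theorem integrable (hV : IsDecaying V) (hZ : IsJost V v Z) (i : Fin 3) :
    Integrable fun y => (V y).mulVec (Z y) i := by
  obtain ⟨B, hB⟩ := hZ.2.1
  exact (hV.integrable_mulVec hZ.1 hB).eval i

theorem hasDerivAt (hV : IsDecaying V) (hZ : IsJost V v Z) (i : Fin 3) (x : ℝ) :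
    HasDerivAt (fun x => Z x i) ((V x).mulVec (Z x) i) x := by
  have h := (hasDerivAt_integral_Ioi ((continuous_apply i).comp (hV.continuous_mulVec hZ.1))
    (hZ.integrable hV i) x).const_sub (v i)
  rw [neg_neg] at h
  exact h.congr_of_eventuallyEq (Eventually.of_forall fun x => hZ.2.2 x i)

theorem tendsto_atTop (hZ : IsJost V v Z) (i : Fin 3) :
    Tendsto (fun x => Z x i) atTop (𝓝 (v i)) := by
  have h := (tendsto_integral_Ioi_zero (f := fun y => (V y).mulVec (Z y) i) (μ := volume)
    (tendsto_id (α := ℝ) (x := atTop))).const_sub (v i)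
  rw [sub_zero] at h
  exact h.congr fun x => (hZ.2.2 x i).symm

theorem tendsto_atBot (hV : IsDecaying V) (hZ : IsJost V v Z) (i : Fin 3) :
    Tendsto (fun x => Z x i) atBot (𝓝 (v i - ∫ y, (V y).mulVec (Z y) i)) :=
  ((tendsto_integral_Ioi_atBot (hZ.integrable hV i)).const_sub (v i)).congr
    fun x => (hZ.2.2 x i).symm

theorem bounded (hZ : IsJost V v Z) : ∃ B : ℝ, 0 ≤ B ∧ ∀ x i, ‖Z x i‖ ≤ B := by
  obtain ⟨B, hB⟩ := hZ.2.1
  exact ⟨B, (norm_nonneg _).trans (hB 0), fun x i => (norm_le_pi_norm _ i).trans (hB x)⟩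

end IsJost

theorem exp_cancel_mulVec (U : Matrix (Fin 3) (Fin 3) ℂ) (d z : Fin 3 → ℂ) (y : ℝ) (i : Fin 3) :
    (Matrix.of fun i m => Complex.exp (-(y : ℂ) * (d i - d m)) * U i m).mulVec
      (fun m => Complex.exp (-(y : ℂ) * d m) * z m) i =
    Complex.exp (-(y : ℂ) * d i) * U.mulVec z i := by
  simp only [Matrix.mulVec, dotProduct, Matrix.of_apply, Finset.mul_sum]
  refine Finset.sum_congr rfl fun m _ => ?_
  rw [show -(y : ℂ) * d i = -(y : ℂ) * (d i - d m) + -(y : ℂ) * d m by ring, Complex.exp_add]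
  ring

/-- Removal of the oscillating factors from a Volterra equation. -/
theorem isJost_twist_iff (U : ℝ → Matrix (Fin 3) (Fin 3) ℂ) {d : Fin 3 → ℂ}
    (hd : ∀ i, (d i).re = 0) {j : Fin 3} (hj : d j = 0) (Y : ℝ → Fin 3 → ℂ) :
    IsJost (fun y => Matrix.of fun i m => Complex.exp (-(y : ℂ) * (d i - d m)) * U y i m)
      (fun i => (1 : Matrix (Fin 3) (Fin 3) ℂ) i j) (fun x i => Complex.exp (-(x : ℂ) * d i) * Y x i) ↔
    Continuous Y ∧ (∃ B : ℝ, ∀ x, ‖Y x‖ ≤ B) ∧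
      ∀ x i, Y x i = (1 : Matrix (Fin 3) (Fin 3) ℂ) i j -
        ∫ y in Set.Ioi x, Complex.exp (((x - y : ℝ) : ℂ) * d i) * (U y).mulVec (Y y) i := by
  have hn : ∀ (x : ℝ) i, ‖Complex.exp (-(x : ℂ) * d i)‖ = 1 := fun x i => by
    simp [Complex.norm_exp, hd]
  have hne : ∀ (x : ℝ) i, Complex.exp (-(x : ℂ) * d i) ≠ 0 := fun x i => Complex.exp_ne_zero _
  refine and_congr ?_ (and_congr ?_ ?_)
  · refine ⟨fun h => continuous_pi fun i => ?_, fun h => by fun_prop⟩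
    have h1 := (continuous_pi_iff.1 h i)
    have h2 : Continuous fun x : ℝ => (Complex.exp (-(x : ℂ) * d i))⁻¹ *
      (Complex.exp (-(x : ℂ) * d i) * Y x i) := ((by fun_prop : Continuous fun x : ℝ =>
        Complex.exp (-(x : ℂ) * d i)).inv₀ fun x => hne x i).mul h1
    exact h2.congr fun x => inv_mul_cancel_left₀ (hne x i) _
  -- The factors are unimodular, because the `d i` are purely imaginary, so the sup norm is
  -- unchanged.
  · have : ∀ x : ℝ, ‖fun i => Complex.exp (-(x : ℂ) * d i) * Y x i‖ = ‖Y x‖ := fun x => by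
      simp only [Pi.norm_def, ← norm_toNNReal, norm_mul, hn, one_mul]
    simp only [this]
  · simp only [exp_cancel_mulVec]
    refine forall_congr' fun x => forall_congr' fun i => ?_
    -- The only nonzero entry of the constant term is at `i = j`, where the factor is 1 because `d j
    -- = 0`.
    have h1 : (1 : Matrix (Fin 3) (Fin 3) ℂ) i j =
        Complex.exp (-(x : ℂ) * d i) * (1 : Matrix (Fin 3) (Fin 3) ℂ) i j := by
      by_cases h : i = j
      · subst h
        simp [hj]
      · simp [h]
    have h2 : ∫ y in Set.Ioi x, Complex.exp (-(y : ℂ) * d i) * (U y).mulVec (Y y) i =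
        Complex.exp (-(x : ℂ) * d i) * ∫ y in Set.Ioi x,
          Complex.exp (((x - y : ℝ) : ℂ) * d i) * (U y).mulVec (Y y) i := by
      rw [← integral_const_mul]
      congr 1 with y
      rw [← mul_assoc, ← Complex.exp_add]
      congr 2
      push_cast
      ring
    rw [h2]
    nth_rewrite 1 [h1]
    rw [← mul_sub]
    exact mul_right_inj' (hne x i)

/-! ### Cube roots of unity and the exponents on the unit circle -/

theorem om_eq : om = ⟨-1 / 2, Real.sqrt 3 / 2⟩ := by
  have h : (2 * Real.pi * Complex.I / 3 : ℂ) = ((2 * Real.pi / 3 : ℝ) : ℂ) * Complex.I := by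
    push_cast
    ring
  have h2 : 2 * Real.pi / 3 = Real.pi - Real.pi / 3 := by ring
  rw [om, h, Complex.exp_mul_I, ← Complex.ofReal_cos, ← Complex.ofReal_sin, h2,
    Real.cos_pi_sub, Real.sin_pi_sub, Real.cos_pi_div_three, Real.sin_pi_div_three]
  apply Complex.ext
  · simp
    norm_num
  · simp

theorem om_sq_eq : om ^ 2 = ⟨-1 / 2, -(Real.sqrt 3 / 2)⟩ := by
  have h := Real.mul_self_sqrt (show (0 : ℝ) ≤ 3 by norm_num)
  rw [om_eq, sq]
  apply Complex.ext <;> simp <;> nlinarith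

theorem om_pow_three : om ^ 3 = 1 := by
  have h := Real.mul_self_sqrt (show (0 : ℝ) ≤ 3 by norm_num)
  rw [pow_succ, om_sq_eq, om_eq]
  apply Complex.ext
  · simp
    nlinarith
  · simp
    nlinarith

theorem om_ne_zero : om ≠ 0 := fun h => by simpa [h] using om_pow_three

theorem om_inv : om⁻¹ = om ^ 2 := by
  exact inv_eq_of_mul_eq_one_right (by rw [← pow_succ', om_pow_three])

theorem one_add_om_add_sq : 1 + om + om ^ 2 = 0 := by
  rw [om_sq_eq, om_eq]
  apply Complex.ext
  · simp
    ring
  · simp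

theorem norm_om : ‖om‖ = 1 := by
  have h : ‖om‖ ^ 3 = 1 := by rw [← norm_pow, om_pow_three, norm_one]
  exact (pow_eq_one_iff_of_nonneg (norm_nonneg _) (by norm_num)).1 h

theorem mem_circle {k : ℂ} : k ∈ circle ↔ ‖k‖ = 1 := by simp [circle]

theorem im_om_mul (k : ℂ) : (om * k).im = -k.im / 2 + Real.sqrt 3 * k.re / 2 := by
  rw [om_eq]
  simp
  ring

theorem im_om_sq_mul (k : ℂ) : (om ^ 2 * k).im = -k.im / 2 - Real.sqrt 3 * k.re / 2 := by
  rw [om_sq_eq]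
  simp
  ring

theorem ell_eq {k : ℂ} (hk : k ∈ circle) (j : Fin 3) :
    ell j k = Complex.I * (((om ^ ((j : ℕ) + 1) * k).re / Real.sqrt 3 : ℝ) : ℂ) := by
  have h : ‖om ^ ((j : ℕ) + 1) * k‖ = 1 := by
    rw [norm_mul, norm_pow, norm_om, one_pow, one_mul, mem_circle.1 hk]
  rw [ell, Complex.inv_eq_conj h, Complex.add_conj]
  push_cast
  field_simp

theorem ell_re {k : ℂ} (hk : k ∈ circle) (j : Fin 3) : (ell j k).re = 0 := by
  rw [ell_eq hk, Complex.re_mul_ofReal, Complex.I_re, zero_mul]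

theorem conj_ell {k : ℂ} (hk : k ∈ circle) (j : Fin 3) :
    (starRingEnd ℂ) (ell j k) = -ell j k := by
  rw [ell_eq hk, map_mul, Complex.conj_I, Complex.conj_ofReal, neg_mul]

theorem sqrt_three_mul_self : Real.sqrt 3 * Real.sqrt 3 = 3 :=
  Real.mul_self_sqrt (by norm_num)

theorem ell_sub_ell_01 {k : ℂ} (hk : k ∈ circle) :
    ell 0 k - ell 1 k = -(Complex.I * (k.im : ℂ)) := by
  have h0 : Real.sqrt 3 ≠ 0 := by positivity
  rw [ell_eq hk, ell_eq hk, ← mul_sub, ← Complex.ofReal_sub, ← mul_neg, ← Complex.ofReal_neg]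
  congr 2
  simp only [Fin.val_zero, Fin.val_one, zero_add, pow_one, one_add_one_eq_two]
  rw [om_sq_eq, om_eq]
  simp only [Complex.mul_re]
  field_simp
  ring

theorem ell_sub_ell_12 {k : ℂ} (hk : k ∈ circle) :
    ell 1 k - ell 2 k = -(Complex.I * ((om * k).im : ℂ)) := by
  have h3 := sqrt_three_mul_self
  have h0 : Real.sqrt 3 ≠ 0 := by positivity
  rw [ell_eq hk, ell_eq hk, ← mul_sub, ← Complex.ofReal_sub, ← mul_neg, ← Complex.ofReal_neg]
  congr 2
  have : ((2 : Fin 3) : ℕ) + 1 = 3 := rfl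
  simp only [this, Fin.val_one, one_add_one_eq_two, om_pow_three]
  rw [im_om_mul, om_sq_eq]
  simp only [Complex.mul_re, one_mul]
  field_simp
  linear_combination k.re * h3

theorem ell_sub_ell_20 {k : ℂ} (hk : k ∈ circle) :
    ell 2 k - ell 0 k = -(Complex.I * ((om ^ 2 * k).im : ℂ)) := by
  have h1 := ell_sub_ell_01 hk
  have h2 := ell_sub_ell_12 hk
  rw [im_om_mul] at h2
  rw [im_om_sq_mul]
  push_cast at *
  linear_combination -h1 - h2

theorem mem_Q_iff {k : ℂ} (hk : k ∈ circle) :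
    k ∈ Q ↔ k.im * (om * k).im * (om ^ 2 * k).im = 0 := by
  have h3 := sqrt_three_mul_self
  -- The three factors are the sines of θ, θ + 2π/3 and θ + 4π/3, whose product is −sin(3θ)/4. On
  -- the circle, k⁶ = 1 means that k³ is real.
  have h1 : k.im * (om * k).im * (om ^ 2 * k).im = -(k ^ 3).im / 4 := by
    rw [im_om_mul, im_om_sq_mul, pow_succ, sq]
    simp only [Complex.mul_im, Complex.mul_re]
    linear_combination (-k.im * k.re ^ 2 / 4) * h3
  have h2 : ‖k ^ 3‖ = 1 := by rw [norm_pow, mem_circle.1 hk, one_pow]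
  have h4 : (k ^ 3).re * (k ^ 3).re + (k ^ 3).im * (k ^ 3).im = 1 := by
    rw [← Complex.normSq_apply, Complex.normSq_eq_norm_sq, h2, one_pow]
  have h5 : k ∈ Q ↔ k ^ 3 * k ^ 3 = 1 := by
    rw [← pow_add]
    rfl
  rw [h1, h5]
  constructor
  · intro h
    have hr := congrArg Complex.re h
    rw [Complex.mul_re, Complex.one_re] at hr
    have : (k ^ 3).im = 0 := by nlinarith
    rw [this]
    norm_num
  · intro h
    have h6 : (k ^ 3).im = 0 := by linarith
    rw [h6] at h4
    apply Complex.ext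
    · rw [Complex.mul_re, h6, Complex.one_re]
      linarith
    · rw [Complex.mul_im, h6, Complex.one_im]
      ring

/-- The derivative of the characteristic polynomial at its `i`-th root `l_i(k)`, `k` on the unit
circle. It is real and its sign tells whether `l_i(k)` lies between the other two roots. -/
def dChar (k : ℂ) : Fin 3 → ℝ :=
  ![k.im * (om ^ 2 * k).im, k.im * (om * k).im, (om * k).im * (om ^ 2 * k).im]

theorem im_ne_zero {k : ℂ} (hk : k ∈ circle \ Q) :
    k.im ≠ 0 ∧ (om * k).im ≠ 0 ∧ (om ^ 2 * k).im ≠ 0 := by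
  have h := hk.2
  rw [mem_Q_iff hk.1] at h
  simpa [and_assoc] using h

theorem dChar_ne_zero {k : ℂ} (hk : k ∈ circle \ Q) (i : Fin 3) : dChar k i ≠ 0 := by
  obtain ⟨h1, h2, h3⟩ := im_ne_zero hk
  fin_cases i
  exacts [mul_ne_zero h1 h3, mul_ne_zero h1 h2, mul_ne_zero h2 h3]

theorem dChar_zero_eq {k : ℂ} (hk : k ∈ circle) :
    (dChar k 0 : ℂ) = (ell 0 k - ell 1 k) * (ell 0 k - ell 2 k) := by
  rw [← neg_sub (ell 2 k), ell_sub_ell_01 hk, ell_sub_ell_20 hk]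
  simp only [dChar, Matrix.cons_val_zero]
  push_cast
  linear_combination ((k.im : ℂ) * ((om ^ 2 * k).im : ℂ)) * Complex.I_sq

theorem dChar_one_eq {k : ℂ} (hk : k ∈ circle) :
    (dChar k 1 : ℂ) = (ell 1 k - ell 0 k) * (ell 1 k - ell 2 k) := by
  rw [← neg_sub (ell 0 k), ell_sub_ell_01 hk, ell_sub_ell_12 hk]
  simp only [dChar, Matrix.cons_val_one, Matrix.cons_val_zero]
  push_cast
  linear_combination ((k.im : ℂ) * ((om * k).im : ℂ)) * Complex.I_sq

theorem dChar_two_eq {k : ℂ} (hk : k ∈ circle) :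
    (dChar k 2 : ℂ) = (ell 2 k - ell 0 k) * (ell 2 k - ell 1 k) := by
  rw [← neg_sub (ell 1 k), ell_sub_ell_20 hk, ell_sub_ell_12 hk]
  simp only [dChar, Matrix.cons_val]
  push_cast
  linear_combination (((om * k).im : ℂ) * ((om ^ 2 * k).im : ℂ)) * Complex.I_sq

theorem ell_distinct {k : ℂ} (hk : k ∈ circle \ Q) :
    ell 0 k - ell 1 k ≠ 0 ∧ ell 1 k - ell 2 k ≠ 0 ∧ ell 2 k - ell 0 k ≠ 0 := by
  obtain ⟨h1, h2, h3⟩ := im_ne_zero hk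
  rw [ell_sub_ell_01 hk.1, ell_sub_ell_12 hk.1, ell_sub_ell_20 hk.1]
  simp [h1, h2, h3, -Complex.mul_im]

/-- Lagrange interpolation at the points `l_i(k)`. -/
theorem sum_ell_pow_div {k : ℂ} (hk : k ∈ circle \ Q) (a : Fin 3) :
    ∑ i, ell i k ^ (a : ℕ) * (dChar k i : ℂ)⁻¹ = if a = 2 then 1 else 0 := by
  obtain ⟨h1, h2, h3⟩ := ell_distinct hk
  have h1' : ell 1 k - ell 0 k ≠ 0 := by rwa [← neg_sub, neg_ne_zero]
  have h2' : ell 2 k - ell 1 k ≠ 0 := by rwa [← neg_sub, neg_ne_zero]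
  have h3' : ell 0 k - ell 2 k ≠ 0 := by rwa [← neg_sub, neg_ne_zero]
  rw [Fin.sum_univ_three, dChar_zero_eq hk.1, dChar_one_eq hk.1, dChar_two_eq hk.1]
  fin_cases a <;> simp <;> field_simp <;> ring

/-! ### The matrices P and U -/

theorem isUnit_det_Pmat {k : ℂ} (hk : k ∈ circle \ Q) : IsUnit (Pmat k).det := by
  have h : Pmat k = (Matrix.vandermonde fun j => ell j k).transpose := rfl
  obtain ⟨h1, h2, h3⟩ := ell_distinct hk
  rw [h, Matrix.det_transpose, isUnit_iff_ne_zero, Matrix.det_vandermonde_ne_zero_iff]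
  intro i j hij
  fin_cases i <;> fin_cases j <;> simp_all

/-- Lagrange interpolation says that P sends the vector (1/d_i) to the last basis vector. -/
theorem inv_Pmat_apply_two {k : ℂ} (hk : k ∈ circle \ Q) (i : Fin 3) :
    (Pmat k)⁻¹ i 2 = (dChar k i : ℂ)⁻¹ := by
  have h : (Pmat k).mulVec (fun i => (dChar k i : ℂ)⁻¹) = Pi.single 2 1 := by
    ext a
    rw [Pi.single_apply]
    exact sum_ell_pow_div hk a
  have h2 := congrArg ((Pmat k)⁻¹.mulVec) h
  rw [Matrix.mulVec_mulVec, Matrix.nonsing_inv_mul _ (isUnit_det_Pmat hk), Matrix.one_mulVec] at h2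
  rw [congrFun h2 i, Matrix.mulVec_single_one]
  rfl

/-- Only the last row of W is nonzero, so U has rank at most one: the last column of P⁻¹ times the
row (W₃₁, W₃₂, 0) P. -/
theorem Umat_apply (u₀ v₀ : SchwartzMap ℝ ℝ) (x : ℝ) {k : ℂ} (hk : k ∈ circle \ Q) (i j : Fin 3) :
    Umat u₀ v₀ x k i j = (dChar k i : ℂ)⁻¹ * (Wmat u₀ v₀ x 2 0 + Wmat u₀ v₀ x 2 1 * ell j k) := by
  rw [← inv_Pmat_apply_two hk, Umat, Matrix.mul_assoc, Matrix.mul_apply, Fin.sum_univ_three]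
  simp only [Matrix.mul_apply, Fin.sum_univ_three]
  simp [Wmat, Pmat]

/-! ### The interaction picture, with s and s^A as limits at −∞ -/

theorem exists_bound_inv_one_add_sq (g : SchwartzMap ℝ ℝ) :
    ∃ C : ℝ, 0 ≤ C ∧ ∀ x, |g x| ≤ C * (1 + x ^ 2)⁻¹ := by
  obtain ⟨A, hA0, hA⟩ := g.decay 0 0
  obtain ⟨B, hB0, hB⟩ := g.decay 2 0
  refine ⟨A + B, by positivity, fun x => ?_⟩
  have h1 := hA x
  have h2 := hB x
  simp only [norm_iteratedFDeriv_zero, Real.norm_eq_abs, sq_abs, pow_zero, one_mul] at h1 h2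
  rw [← div_eq_mul_inv, le_div_iff₀ (by positivity)]
  linarith

/-- The potential in the interaction picture, `e^{-x ad L(k)} U(x,k)`. -/
def Vmat (u₀ v₀ : SchwartzMap ℝ ℝ) (k : ℂ) (x : ℝ) : Matrix (Fin 3) (Fin 3) ℂ :=
  Matrix.of fun i m => Complex.exp (-(x : ℂ) * (ell i k - ell m k)) * Umat u₀ v₀ x k i m

variable {u₀ v₀ : SchwartzMap ℝ ℝ} {k : ℂ}

theorem norm_exp_ell (hk : k ∈ circle) (x : ℝ) (i m : Fin 3) :
    ‖Complex.exp (-(x : ℂ) * (ell i k - ell m k))‖ = 1 := by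
  simp [Complex.norm_exp, ell_re hk]

theorem isDecaying_Vmat (u₀ v₀ : SchwartzMap ℝ ℝ) (hk : k ∈ circle \ Q) :
    IsDecaying (Vmat u₀ v₀ k) := by
  have hdu : ∀ x, deriv u₀ x = SchwartzMap.derivCLM ℝ ℝ u₀ x := fun x =>
    (SchwartzMap.derivCLM_apply ℝ u₀ x).symm
  have hduc : Continuous (deriv u₀) := by
    rw [show deriv u₀ = SchwartzMap.derivCLM ℝ ℝ u₀ from funext hdu]
    exact (SchwartzMap.derivCLM ℝ ℝ u₀).continuous
  have huc := u₀.continuous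
  have hvc := v₀.continuous
  constructor
  · refine continuous_pi fun i => continuous_pi fun m => ?_
    simp only [Vmat, Matrix.of_apply, Umat_apply u₀ v₀ _ hk]
    simp only [Wmat, Matrix.of_apply, Matrix.cons_val', Matrix.cons_val]
    fun_prop
  · obtain ⟨A, hA0, hA⟩ := exists_bound_inv_one_add_sq u₀
    obtain ⟨B, hB0, hB⟩ := exists_bound_inv_one_add_sq v₀
    obtain ⟨C, hC0, hC⟩ := exists_bound_inv_one_add_sq (SchwartzMap.derivCLM ℝ ℝ u₀)
    have hbound : ∀ y i m, ‖Vmat u₀ v₀ k y i m‖ ≤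
        (|dChar k i|⁻¹ * ((C + B) + A * ‖ell m k‖)) * (1 + y ^ 2)⁻¹ := by
      intro y i m
      have h2 : 0 ≤ (1 + y ^ 2)⁻¹ := by positivity
      have h3 : (1 : ℝ) ≤ Real.sqrt 3 := by
        rw [Real.one_le_sqrt]
        norm_num
      have ha : ‖Wmat u₀ v₀ y 2 0‖ ≤ (C + B) * (1 + y ^ 2)⁻¹ := by
        calc ‖Wmat u₀ v₀ y 2 0‖ ≤ ‖-((deriv u₀ y : ℝ) : ℂ) / 4‖ +
              ‖Complex.I * ((v₀ y : ℝ) : ℂ) / (4 * (Real.sqrt 3 : ℂ))‖ := norm_sub_le _ _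
          _ = |deriv u₀ y| / 4 + |v₀ y| / (4 * Real.sqrt 3) := by
              simp [abs_of_nonneg (Real.sqrt_nonneg 3)]
          _ ≤ |deriv u₀ y| + |v₀ y| := by
              gcongr
              · exact div_le_self (abs_nonneg _) (by norm_num)
              · exact div_le_self (abs_nonneg _) (by linarith)
          _ ≤ C * (1 + y ^ 2)⁻¹ + B * (1 + y ^ 2)⁻¹ := by
              gcongr
              · rw [hdu]
                exact hC y
              · exact hB y
          _ = _ := by ring
      have hb : ‖Wmat u₀ v₀ y 2 1‖ ≤ A * (1 + y ^ 2)⁻¹ := by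
        calc ‖Wmat u₀ v₀ y 2 1‖ = ‖-((u₀ y : ℝ) : ℂ) / 2‖ := rfl
          _ = |u₀ y| / 2 := by simp
          _ ≤ |u₀ y| := half_le_self (abs_nonneg _)
          _ ≤ _ := hA y
      rw [Vmat, Matrix.of_apply, norm_mul, norm_exp_ell hk.1, one_mul, Umat_apply _ _ _ hk,
        norm_mul, norm_inv, Complex.norm_real, Real.norm_eq_abs, mul_assoc]
      gcongr
      calc _ ≤ ‖Wmat u₀ v₀ y 2 0‖ + ‖Wmat u₀ v₀ y 2 1‖ * ‖ell m k‖ :=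
            (norm_add_le _ _).trans (by rw [norm_mul])
        _ ≤ (C + B) * (1 + y ^ 2)⁻¹ + A * (1 + y ^ 2)⁻¹ * ‖ell m k‖ := by gcongr
        _ = _ := by ring
    refine ⟨∑ i, ∑ m, |dChar k i|⁻¹ * ((C + B) + A * ‖ell m k‖), by positivity,
      fun y i m => (hbound y i m).trans ?_⟩
    have h2 : 0 ≤ (1 + y ^ 2)⁻¹ := by positivity
    gcongr
    exact (Finset.single_le_sum (f := fun m => |dChar k i|⁻¹ * ((C + B) + A * ‖ell m k‖))
      (fun _ _ => by positivity) (Finset.mem_univ m)).trans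
      (Finset.single_le_sum (f := fun i => ∑ m, |dChar k i|⁻¹ * ((C + B) + A * ‖ell m k‖))
        (fun _ _ => by positivity) (Finset.mem_univ i))

theorem Vmat_eq (u₀ v₀ : SchwartzMap ℝ ℝ) (k : ℂ) (j : Fin 3) :
    Vmat u₀ v₀ k = fun y : ℝ => Matrix.of fun i m =>
      Complex.exp (-(y : ℂ) * ((ell i k - ell j k) - (ell m k - ell j k))) * Umat u₀ v₀ y k i m := by
  simp only [sub_sub_sub_cancel_right]
  rfl

theorem neg_transpose_Vmat_eq (u₀ v₀ : SchwartzMap ℝ ℝ) (k : ℂ) (j : Fin 3) :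
    (fun y => -(Vmat u₀ v₀ k y).transpose) = fun y : ℝ => Matrix.of fun i m =>
      Complex.exp (-(y : ℂ) * (-(ell i k - ell j k) - -(ell m k - ell j k))) *
        (-(Umat u₀ v₀ y k).transpose) i m := by
  ext y i m
  have h : -(ell i k - ell j k) - -(ell m k - ell j k) = ell m k - ell i k := by ring
  change -Vmat u₀ v₀ k y m i = Complex.exp _ * -Umat u₀ v₀ y k m i
  rw [h, Vmat, Matrix.of_apply, mul_neg]

theorem isXColumn_iff (hk : k ∈ circle) (j : Fin 3) (Y : ℝ → Fin 3 → ℂ) :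
    IsXColumn u₀ v₀ k j Y ↔ IsJost (Vmat u₀ v₀ k) (fun i => (1 : Matrix (Fin 3) (Fin 3) ℂ) i j)
      (fun x i => Complex.exp (-(x : ℂ) * (ell i k - ell j k)) * Y x i) := by
  rw [Vmat_eq u₀ v₀ k j, isJost_twist_iff (fun y => Umat u₀ v₀ y k) (d := fun i => ell i k - ell j k)
    (fun i => by simp [ell_re hk]) (sub_self _)]
  rfl

theorem isXAColumn_iff (hk : k ∈ circle) (j : Fin 3) (Y : ℝ → Fin 3 → ℂ) :
    IsXAColumn u₀ v₀ k j Y ↔ IsJost (fun y => -(Vmat u₀ v₀ k y).transpose)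
      (fun i => (1 : Matrix (Fin 3) (Fin 3) ℂ) i j)
      (fun x i => Complex.exp (-(x : ℂ) * -(ell i k - ell j k)) * Y x i) := by
  rw [neg_transpose_Vmat_eq u₀ v₀ k j, isJost_twist_iff (fun y => -(Umat u₀ v₀ y k).transpose)
    (d := fun i => -(ell i k - ell j k)) (fun i => by simp [ell_re hk]) (by simp)]
  simp only [IsXAColumn, Matrix.neg_mulVec, Pi.neg_apply, mul_neg, integral_neg, sub_neg_eq_add,
    neg_mul]

theorem exists_isXColumn (u₀ v₀ : SchwartzMap ℝ ℝ) (hk : k ∈ circle \ Q) (j : Fin 3) :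
    ∃ Y, IsXColumn u₀ v₀ k j Y := by
  obtain ⟨Z, hZ, -⟩ := (isDecaying_Vmat u₀ v₀ hk).existsUnique_isJost
    fun i => (1 : Matrix (Fin 3) (Fin 3) ℂ) i j
  refine ⟨fun x i => Complex.exp ((x : ℂ) * (ell i k - ell j k)) * Z x i,
    (isXColumn_iff hk.1 j _).2 ?_⟩
  simpa only [← mul_assoc, ← Complex.exp_add, neg_mul, neg_add_cancel, Complex.exp_zero,
    one_mul] using hZ

theorem exists_isXAColumn (u₀ v₀ : SchwartzMap ℝ ℝ) (hk : k ∈ circle \ Q) (j : Fin 3) :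
    ∃ Y, IsXAColumn u₀ v₀ k j Y := by
  obtain ⟨Z, hZ, -⟩ := (isDecaying_Vmat u₀ v₀ hk).neg_transpose.existsUnique_isJost
    fun i => (1 : Matrix (Fin 3) (Fin 3) ℂ) i j
  refine ⟨fun x i => Complex.exp ((x : ℂ) * -(ell i k - ell j k)) * Z x i,
    (isXAColumn_iff hk.1 j _).2 ?_⟩
  simpa only [← mul_assoc, ← Complex.exp_add, neg_mul, neg_add_cancel, Complex.exp_zero,
    one_mul] using hZ

/-- The solution chosen by `Classical.epsilon` is, after the twist, a Jost solution. By uniqueness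
it is Z, and the integral defining s is the one in the limit of Z at −∞. -/
theorem tendsto_s (hk : k ∈ circle \ Q) {j : Fin 3} {Z : ℝ → Fin 3 → ℂ}
    (hZ : IsJost (Vmat u₀ v₀ k) (fun i => (1 : Matrix (Fin 3) (Fin 3) ℂ) i j) Z) (i : Fin 3) :
    Tendsto (fun x => Z x i) atBot (𝓝 (s u₀ v₀ k i j)) := by
  have hV := isDecaying_Vmat u₀ v₀ hk
  have hX := (isXColumn_iff hk.1 j _).1 (Classical.epsilon_spec (exists_isXColumn u₀ v₀ hk j))
  rw [(hV.existsUnique_isJost _).unique hZ hX]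
  convert hX.tendsto_atBot hV i using 2
  rw [Vmat_eq u₀ v₀ k j]
  simp only [exp_cancel_mulVec]
  rfl

theorem tendsto_sA (hk : k ∈ circle \ Q) {j : Fin 3} {Z : ℝ → Fin 3 → ℂ}
    (hZ : IsJost (fun y => -(Vmat u₀ v₀ k y).transpose)
      (fun i => (1 : Matrix (Fin 3) (Fin 3) ℂ) i j) Z) (i : Fin 3) :
    Tendsto (fun x => Z x i) atBot (𝓝 (sA u₀ v₀ k i j)) := by
  have hV := (isDecaying_Vmat u₀ v₀ hk).neg_transpose
  have hX := (isXAColumn_iff hk.1 j _).1 (Classical.epsilon_spec (exists_isXAColumn u₀ v₀ hk j))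
  rw [(hV.existsUnique_isJost _).unique hZ hX]
  convert hX.tendsto_atBot hV i using 2
  have h := fun y => congrFun (neg_transpose_Vmat_eq u₀ v₀ k j) y
  have h2 := fun y : ℝ => exp_cancel_mulVec (-(Umat u₀ v₀ y k).transpose)
    (fun i => -(ell i k - ell j k)) (Classical.epsilon (IsXAColumn u₀ v₀ k j) y) y i
  simp only [h, h2]
  simp only [Matrix.neg_mulVec, Pi.neg_apply, mul_neg, integral_neg, sub_neg_eq_add, neg_mul,
    neg_neg]
  rfl

/-! ### The two conserved pairings -/

theorem eq_of_hasDerivAt_zero_of_tendsto {g : ℝ → ℂ} (hg : ∀ x, HasDerivAt g 0 x) {a b : ℂ}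
    (ha : Tendsto g atBot (𝓝 a)) (hb : Tendsto g atTop (𝓝 b)) : a = b := by
  have hc : ∀ x, g x = g 0 := fun x =>
    is_const_of_deriv_eq_zero (fun x => (hg x).differentiableAt) (fun x => (hg x).deriv) x 0
  have h1 : a = g 0 := tendsto_nhds_unique ha (tendsto_const_nhds.congr fun x => (hc x).symm)
  have h2 : b = g 0 := tendsto_nhds_unique hb (tendsto_const_nhds.congr fun x => (hc x).symm)
  rw [h1, h2]

/-- The pairing ∑ T_i Z_i of a solution of T' = −VᵀT with one of Z' = VZ is constant. Its limits at
−∞ and +∞ are the corresponding entries of (s^A)ᵀ s and I. -/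
theorem transpose_sA_mul_s (u₀ v₀ : SchwartzMap ℝ ℝ) (hk : k ∈ circle \ Q) :
    (sA u₀ v₀ k).transpose * s u₀ v₀ k = 1 := by
  have hV := isDecaying_Vmat u₀ v₀ hk
  have hW := hV.neg_transpose
  ext a b
  obtain ⟨Z, hZ, -⟩ := hV.existsUnique_isJost fun i => (1 : Matrix (Fin 3) (Fin 3) ℂ) i b
  obtain ⟨T, hT, -⟩ := hW.existsUnique_isJost fun i => (1 : Matrix (Fin 3) (Fin 3) ℂ) i a
  have hbot : Tendsto (fun x => ∑ i, T x i * Z x i) atBot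
      (𝓝 (∑ i, sA u₀ v₀ k i a * s u₀ v₀ k i b)) :=
    tendsto_finsetSum _ fun i _ => (tendsto_sA hk hT i).mul (tendsto_s hk hZ i)
  have htop : Tendsto (fun x => ∑ i, T x i * Z x i) atTop
      (𝓝 (∑ i, (1 : Matrix (Fin 3) (Fin 3) ℂ) i a * (1 : Matrix (Fin 3) (Fin 3) ℂ) i b)) :=
    tendsto_finsetSum _ fun i _ => (hT.tendsto_atTop i).mul (hZ.tendsto_atTop i)
  have hd : ∀ x, HasDerivAt (fun x => ∑ i, T x i * Z x i) 0 x := by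
    intro x
    refine (HasDerivAt.fun_sum fun i _ => (hT.hasDerivAt hW i x).mul
      (hZ.hasDerivAt hV i x)).congr_deriv ?_
    simp only [Matrix.mulVec, dotProduct, Fin.sum_univ_three, Matrix.neg_apply,
      Matrix.transpose_apply]
    ring
  rw [Matrix.mul_apply]
  simp only [Matrix.transpose_apply]
  rw [eq_of_hasDerivAt_zero_of_tendsto hd hbot htop]
  simp [Matrix.one_apply, eq_comm]

theorem tendsto_potential (u : SchwartzMap ℝ ℝ) {l : Filter ℝ} (hl : l ≤ cocompact ℝ) :
    Tendsto (fun x => ((u x : ℝ) : ℂ)) l (𝓝 0) := by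
  have h := (Complex.continuous_ofReal.tendsto 0).comp ((u.tendsto_cocompact).mono_left hl)
  simpa [Function.comp_def] using h

/-- The differential equation of a Jost solution by components, and the derivative of the scalar
function `∑ e^{x l_m(k)} Z_m(x)`. -/
theorem hasDerivAt_sum_exp_mul (hk : k ∈ circle \ Q) {v : Fin 3 → ℂ} {Z : ℝ → Fin 3 → ℂ}
    (hZ : IsJost (Vmat u₀ v₀ k) v Z) (x : ℝ) :
    (∀ i, HasDerivAt (fun x => Z x i) (Complex.exp (-(x : ℂ) * ell i k) * (dChar k i : ℂ)⁻¹ *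
      (Wmat u₀ v₀ x 2 0 * ∑ m, Complex.exp ((x : ℂ) * ell m k) * Z x m +
        Wmat u₀ v₀ x 2 1 * ∑ m, ell m k * Complex.exp ((x : ℂ) * ell m k) * Z x m)) x) ∧
    HasDerivAt (fun x : ℝ => ∑ m, Complex.exp ((x : ℂ) * ell m k) * Z x m)
      (∑ m, ell m k * Complex.exp ((x : ℂ) * ell m k) * Z x m) x := by
  have h1 : ∀ i, HasDerivAt (fun x => Z x i) (Complex.exp (-(x : ℂ) * ell i k) *
      (dChar k i : ℂ)⁻¹ *
      (Wmat u₀ v₀ x 2 0 * ∑ m, Complex.exp ((x : ℂ) * ell m k) * Z x m +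
        Wmat u₀ v₀ x 2 1 * ∑ m, ell m k * Complex.exp ((x : ℂ) * ell m k) * Z x m)) x := by
    intro i
    refine (hZ.hasDerivAt (isDecaying_Vmat u₀ v₀ hk) i x).congr_deriv ?_
    simp only [Matrix.mulVec, dotProduct, Vmat, Matrix.of_apply, Umat_apply u₀ v₀ x hk]
    rw [Finset.mul_sum, Finset.mul_sum, ← Finset.sum_add_distrib, Finset.mul_sum]
    refine Finset.sum_congr rfl fun m _ => ?_
    rw [show -(x : ℂ) * (ell i k - ell m k) = -(x : ℂ) * ell i k + (x : ℂ) * ell m k by ring,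
      Complex.exp_add]
    ring
  refine ⟨h1, ?_⟩
  have he : ∀ m, HasDerivAt (fun x : ℝ => Complex.exp ((x : ℂ) * ell m k))
      (Complex.exp ((x : ℂ) * ell m k) * ell m k) x := fun m => by
    have := (((hasDerivAt_id (x : ℂ)).mul_const (ell m k)).cexp).comp_ofReal
    simpa using this
  refine (HasDerivAt.fun_sum fun m _ => (he m).mul (h1 m)).congr_deriv ?_
  rw [Finset.sum_add_distrib]
  -- The derivatives of the Z_m contribute a common factor times ∑ 1/d_m, which vanishes by
  -- interpolation in degree 0.
  have h2 := sum_ell_pow_div hk 0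
  simp only [Fin.val_zero, pow_zero, one_mul] at h2
  rw [if_neg (by decide)] at h2
  set c := Wmat u₀ v₀ x 2 0 * ∑ m, Complex.exp ((x : ℂ) * ell m k) * Z x m +
        Wmat u₀ v₀ x 2 1 * ∑ m, ell m k * Complex.exp ((x : ℂ) * ell m k) * Z x m
  have h3 : ∑ m, Complex.exp ((x : ℂ) * ell m k) *
      (Complex.exp (-(x : ℂ) * ell m k) * (dChar k m : ℂ)⁻¹ * c) = 0 := by
    have h4 : ∀ m, Complex.exp ((x : ℂ) * ell m k) *
        (Complex.exp (-(x : ℂ) * ell m k) * (dChar k m : ℂ)⁻¹ * c) = (dChar k m : ℂ)⁻¹ * c := by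
      intro m
      rw [← mul_assoc, ← mul_assoc, ← Complex.exp_add]
      simp
    rw [Finset.sum_congr rfl fun m _ => h4 m, ← Finset.sum_mul, h2, zero_mul]
  rw [h3, add_zero]
  exact Finset.sum_congr rfl fun m _ => by ring

/-- The real potentials make the underlying third-order scalar equation conserve a Hermitian form.
For φ = ∑ e^{x l_m} Z_m, the derivative of ∑ d_i conj(T_i) Z_i is minus that of (u₀/2) conj(φ_T)
φ_Z. The sum `G` of the two is therefore constant, and its second term tends to 0 at both ends. -/
theorem conjTranspose_s_mul_diagonal_mul_s (u₀ v₀ : SchwartzMap ℝ ℝ) (hk : k ∈ circle \ Q) :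
    (s u₀ v₀ k).conjTranspose * Matrix.diagonal (fun i => (dChar k i : ℂ)) * s u₀ v₀ k =
      Matrix.diagonal fun i => (dChar k i : ℂ) := by
  have hV := isDecaying_Vmat u₀ v₀ hk
  ext a b
  obtain ⟨Z, hZ, -⟩ := hV.existsUnique_isJost fun i => (1 : Matrix (Fin 3) (Fin 3) ℂ) i b
  obtain ⟨T, hT, -⟩ := hV.existsUnique_isJost fun i => (1 : Matrix (Fin 3) (Fin 3) ℂ) i a
  set φ : (ℝ → Fin 3 → ℂ) → ℝ → ℂ := fun Z x => ∑ m, Complex.exp ((x : ℂ) * ell m k) * Z x m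
    with hφ
  set G : ℝ → ℂ := fun x => (∑ i, (dChar k i : ℂ) * (star (T x i) * Z x i)) +
    (u₀ x : ℂ) / 2 * (star (φ T x) * φ Z x) with hG
  have hbound : ∀ {Z : ℝ → Fin 3 → ℂ} {v : Fin 3 → ℂ}, IsJost (Vmat u₀ v₀ k) v Z →
      ∃ B : ℝ, 0 ≤ B ∧ ∀ x, ‖φ Z x‖ ≤ B := by
    intro Z v hZ
    obtain ⟨B, hB0, hB⟩ := hZ.bounded
    refine ⟨∑ _m : Fin 3, B, by positivity, fun x => (norm_sum_le _ _).trans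
      (Finset.sum_le_sum fun m _ => ?_)⟩
    rw [norm_mul, Complex.norm_exp]
    simpa [ell_re hk.1] using hB x m
  have hcorr : ∀ {l : Filter ℝ}, l ≤ cocompact ℝ →
      Tendsto (fun x => (u₀ x : ℂ) / 2 * (star (φ T x) * φ Z x)) l (𝓝 0) := by
    intro l hl
    obtain ⟨A, hA0, hA⟩ := hbound hT
    obtain ⟨B, hB0, hB⟩ := hbound hZ
    have h0 := (tendsto_potential u₀ hl).norm.mul_const (A * B)
    rw [norm_zero, zero_mul] at h0
    refine squeeze_zero_norm (fun x => ?_) h0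
    rw [norm_mul, norm_mul, norm_star, norm_div]
    have : ‖(u₀ x : ℂ)‖ / ‖(2 : ℂ)‖ ≤ ‖(u₀ x : ℂ)‖ :=
      div_le_self (norm_nonneg _) (by norm_num)
    gcongr
    · exact hA x
    · exact hB x
  have hlim : ∀ {l : Filter ℝ} {p q : Fin 3 → ℂ}, l ≤ cocompact ℝ →
      (∀ i, Tendsto (fun x => T x i) l (𝓝 (p i))) → (∀ i, Tendsto (fun x => Z x i) l (𝓝 (q i))) →
      Tendsto G l (𝓝 (∑ i, (dChar k i : ℂ) * (star (p i) * q i))) := by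
    intro l p q hl hp hq
    rw [← add_zero (∑ i, (dChar k i : ℂ) * (star (p i) * q i))]
    exact (tendsto_finsetSum _ fun i _ => ((hp i).star.mul (hq i)).const_mul _).add (hcorr hl)
  have hbot := hlim atBot_le_cocompact (tendsto_s hk hT) (tendsto_s hk hZ)
  have htop := hlim atTop_le_cocompact hT.tendsto_atTop hZ.tendsto_atTop
  have hd : ∀ x, HasDerivAt G 0 x := by
    intro x
    obtain ⟨hT1, hT2⟩ := hasDerivAt_sum_exp_mul hk hT x
    obtain ⟨hZ1, hZ2⟩ := hasDerivAt_sum_exp_mul hk hZ x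
    have hu : HasDerivAt (fun x => (u₀ x : ℂ) / 2) (((deriv u₀ x : ℝ) : ℂ) / 2) x :=
      ((u₀.differentiableAt (x := x)).hasDerivAt.ofReal_comp).div_const 2
    refine ((HasDerivAt.fun_sum fun i _ => ((hT1 i).star.mul (hZ1 i)).const_mul _).add
      (hu.mul (hT2.star.mul hZ2))).congr_deriv ?_
    change _ + (((deriv u₀ x : ℝ) : ℂ) / 2 * (star (φ T x) * φ Z x) + _) = 0
    set ψT := ∑ m, ell m k * Complex.exp ((x : ℂ) * ell m k) * T x m
    set ψZ := ∑ m, ell m k * Complex.exp ((x : ℂ) * ell m k) * Z x m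
    have hexp : ∀ i, star (Complex.exp (-(x : ℂ) * ell i k)) = Complex.exp ((x : ℂ) * ell i k) := by
      intro i
      rw [Complex.star_def, ← Complex.exp_conj]
      simp [conj_ell hk.1]
    have hexp' : ∀ i, star (Complex.exp ((x : ℂ) * ell i k)) = Complex.exp (-(x : ℂ) * ell i k) :=
      fun i => by rw [← hexp, star_star]
    have hdr : ∀ i, star ((dChar k i : ℂ)⁻¹) = (dChar k i : ℂ)⁻¹ := fun i => by simp
    have hne : ∀ i, (dChar k i : ℂ) ≠ 0 := fun i => by exact_mod_cast dChar_ne_zero hk i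
    -- The weight d_i cancels the factor 1/d_i in V, so the exponentials reassemble into φ_T and
    -- φ_Z.
    have hsum : ∑ i, (dChar k i : ℂ) * (star (Complex.exp (-(x : ℂ) * ell i k) *
          (dChar k i : ℂ)⁻¹ * (Wmat u₀ v₀ x 2 0 * φ T x + Wmat u₀ v₀ x 2 1 * ψT)) * Z x i +
        star (T x i) * (Complex.exp (-(x : ℂ) * ell i k) * (dChar k i : ℂ)⁻¹ *
          (Wmat u₀ v₀ x 2 0 * φ Z x + Wmat u₀ v₀ x 2 1 * ψZ))) =
        star (Wmat u₀ v₀ x 2 0 * φ T x + Wmat u₀ v₀ x 2 1 * ψT) * φ Z x +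
        star (φ T x) * (Wmat u₀ v₀ x 2 0 * φ Z x + Wmat u₀ v₀ x 2 1 * ψZ) := by
      generalize Wmat u₀ v₀ x 2 0 * φ T x + Wmat u₀ v₀ x 2 1 * ψT = p
      generalize Wmat u₀ v₀ x 2 0 * φ Z x + Wmat u₀ v₀ x 2 1 * ψZ = q
      rw [hφ]
      simp only [star_sum, Finset.mul_sum, Finset.sum_mul]
      rw [← Finset.sum_add_distrib]
      refine Finset.sum_congr rfl fun i _ => ?_
      rw [star_mul', star_mul', star_mul', hexp, hexp', hdr]
      field_simp [hne i]
    -- Only the real part −u₀'/4 of W₃₁ survives in the sum with its conjugate; the term with v₀ is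
    -- imaginary and cancels.
    have h0 : star (Wmat u₀ v₀ x 2 0) = -((deriv u₀ x : ℝ) : ℂ) / 2 - Wmat u₀ v₀ x 2 0 := by
      simp [Wmat]
      ring
    have h1 : star (Wmat u₀ v₀ x 2 1) = Wmat u₀ v₀ x 2 1 := by simp [Wmat]
    have h2 : (u₀ x : ℂ) / 2 = -Wmat u₀ v₀ x 2 1 := by
      simp [Wmat]
      ring
    have hsum' := hsum
    rw [star_add, star_mul', star_mul', h0, h1] at hsum'
    refine (congrArg (· + _) hsum').trans ?_
    rw [h2]
    change _ + (_ + _ * (star ψT * φ Z x + star (φ T x) * ψZ)) = 0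
    ring
  have key := eq_of_hasDerivAt_zero_of_tendsto hd hbot htop
  rw [Matrix.mul_apply]
  simp only [Matrix.mul_diagonal, Matrix.conjTranspose_apply]
  calc _ = ∑ i, (dChar k i : ℂ) * (star (s u₀ v₀ k i a) * s u₀ v₀ k i b) :=
        Finset.sum_congr rfl fun i _ => by ring
    _ = _ := key
    _ = _ := by
        rw [Finset.sum_eq_single b (fun i _ hi => by simp [hi]) (by simp)]
        by_cases h : a = b
        · subst h
          simp
        · simp [h, Ne.symm h]

/-! ### Symmetries and algebraic relations of s and s^A -/

theorem IsJost.submatrix {V : ℝ → Matrix (Fin 3) (Fin 3) ℂ} {v : Fin 3 → ℂ} {Z : ℝ → Fin 3 → ℂ}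
    (hZ : IsJost V v Z) (π : Equiv.Perm (Fin 3)) :
    IsJost (fun y => (V y).submatrix π π) (fun i => v (π i)) (fun x i => Z x (π i)) := by
  obtain ⟨B, hB0, hB⟩ := hZ.bounded
  refine ⟨continuous_pi fun i => (continuous_apply _).comp hZ.1,
    ⟨B, fun x => (pi_norm_le_iff_of_nonneg hB0).2 fun i => hB x _⟩, fun x i => ?_⟩
  have h : ∀ y, ((V y).submatrix π π).mulVec (fun i => Z y (π i)) i = (V y).mulVec (Z y) (π i) := by
    intro y
    rw [Matrix.submatrix_mulVec_equiv]
    simp [Function.comp_def]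
  simp only [h]
  exact hZ.2.2 x (π i)

variable {k' : ℂ} {π : Equiv.Perm (Fin 3)}

theorem Vmat_submatrix (u₀ v₀ : SchwartzMap ℝ ℝ) (h : ∀ j, ell j k' = ell (π j) k) (x : ℝ) :
    Vmat u₀ v₀ k' x = (Vmat u₀ v₀ k x).submatrix π π := by
  have hP : Pmat k' = (Pmat k).submatrix (Equiv.refl (Fin 3)) π := by
    ext i j
    simp [Pmat, h]
  have hU : Umat u₀ v₀ x k' = (Umat u₀ v₀ x k).submatrix π π := by
    rw [Umat, hP, Matrix.inv_submatrix_equiv, Umat]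
    rfl
  ext i m
  simp [Vmat, hU, h]

/-- A change of k that permutes the exponents merely relabels the components of the system;
uniqueness of Jost solutions transfers this to s. -/
theorem s_symm (u₀ v₀ : SchwartzMap ℝ ℝ) (hk : k ∈ circle \ Q) (hk' : k' ∈ circle \ Q)
    (h : ∀ j, ell j k' = ell (π j) k) (i j : Fin 3) :
    s u₀ v₀ k' i j = s u₀ v₀ k (π i) (π j) := by
  obtain ⟨Z, hZ, -⟩ := (isDecaying_Vmat u₀ v₀ hk).existsUnique_isJost
    fun i => (1 : Matrix (Fin 3) (Fin 3) ℂ) i (π j)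
  refine tendsto_nhds_unique (tendsto_s hk' (Z := fun x i => Z x (π i)) ?_ i) (tendsto_s hk hZ (π i))
  have := hZ.submatrix π
  simpa only [← Vmat_submatrix u₀ v₀ h, Matrix.one_apply, EmbeddingLike.apply_eq_iff_eq] using this

theorem sA_symm (u₀ v₀ : SchwartzMap ℝ ℝ) (hk : k ∈ circle \ Q) (hk' : k' ∈ circle \ Q)
    (h : ∀ j, ell j k' = ell (π j) k) (i j : Fin 3) :
    sA u₀ v₀ k' i j = sA u₀ v₀ k (π i) (π j) := by
  obtain ⟨Z, hZ, -⟩ := (isDecaying_Vmat u₀ v₀ hk).neg_transpose.existsUnique_isJost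
    fun i => (1 : Matrix (Fin 3) (Fin 3) ℂ) i (π j)
  refine tendsto_nhds_unique (tendsto_sA hk' (Z := fun x i => Z x (π i)) ?_ i) (tendsto_sA hk hZ (π i))
  have := hZ.submatrix π
  simpa only [Matrix.submatrix_neg, Pi.neg_apply, ← Matrix.transpose_submatrix,
    ← Vmat_submatrix u₀ v₀ h, Matrix.one_apply, EmbeddingLike.apply_eq_iff_eq] using this

/-- Both (s^A)ᵀ and D⁻¹ s* D are left inverses of s. -/
theorem sA_apply (u₀ v₀ : SchwartzMap ℝ ℝ) (hk : k ∈ circle \ Q) (i j : Fin 3) :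
    sA u₀ v₀ k i j = ((dChar k i / dChar k j : ℝ) : ℂ) * star (s u₀ v₀ k i j) := by
  have hne : ∀ i, (dChar k i : ℂ) ≠ 0 := fun i => by exact_mod_cast dChar_ne_zero hk i
  have h1 : Matrix.diagonal (fun i => (dChar k i : ℂ)⁻¹) * Matrix.diagonal (fun i => (dChar k i : ℂ))
      = 1 := by
    rw [Matrix.diagonal_mul_diagonal, ← Matrix.diagonal_one]
    simp [hne]
  have h2 : (Matrix.diagonal (fun i => (dChar k i : ℂ)⁻¹) * (s u₀ v₀ k).conjTranspose *
      Matrix.diagonal (fun i => (dChar k i : ℂ))) * s u₀ v₀ k = 1 := by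
    rw [Matrix.mul_assoc _ _ (Matrix.diagonal _), Matrix.mul_assoc,
      conjTranspose_s_mul_diagonal_mul_s u₀ v₀ hk, h1]
  have h3 := (Matrix.inv_eq_left_inv (transpose_sA_mul_s u₀ v₀ hk)).symm.trans
    (Matrix.inv_eq_left_inv h2)
  have h4 := congrFun (congrFun h3 j) i
  rw [Matrix.mul_diagonal, Matrix.diagonal_mul, Matrix.transpose_apply,
    Matrix.conjTranspose_apply] at h4
  rw [h4]
  push_cast
  have := hne j
  field_simp

theorem s_mul_sA (u₀ v₀ : SchwartzMap ℝ ℝ) (hk : k ∈ circle \ Q) (i j : Fin 3) :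
    s u₀ v₀ k i j * sA u₀ v₀ k i j =
      ((dChar k i / dChar k j * ‖s u₀ v₀ k i j‖ ^ 2 : ℝ) : ℂ) := by
  rw [sA_apply u₀ v₀ hk, mul_left_comm, Complex.star_def, Complex.mul_conj,
    Complex.normSq_eq_norm_sq, Complex.ofReal_mul]

/-- The first diagonal entry of s (s^A)ᵀ = I. It is what makes the terms of f add up to 1/|s₁₁|². -/
theorem row_identity (u₀ v₀ : SchwartzMap ℝ ℝ) (hk : k ∈ circle \ Q) :
    ‖s u₀ v₀ k 0 0‖ ^ 2 + dChar k 0 / dChar k 1 * ‖s u₀ v₀ k 0 1‖ ^ 2 +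
      dChar k 0 / dChar k 2 * ‖s u₀ v₀ k 0 2‖ ^ 2 = 1 := by
  have h0 : s u₀ v₀ k * (sA u₀ v₀ k).transpose = 1 :=
    mul_eq_one_comm.1 (transpose_sA_mul_s u₀ v₀ hk)
  have h := congrFun (congrFun h0 0) 0
  rw [Matrix.mul_apply, Fin.sum_univ_three] at h
  simp only [Matrix.transpose_apply, s_mul_sA u₀ v₀ hk, Matrix.one_apply_eq,
    div_self (dChar_ne_zero hk 0), one_mul] at h
  exact_mod_cast h

/-- The last diagonal entry of s* D s = D, needed only for ν̂₂. -/
theorem column_identity (u₀ v₀ : SchwartzMap ℝ ℝ) (hk : k ∈ circle \ Q) :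
    dChar k 0 * ‖s u₀ v₀ k 0 2‖ ^ 2 + dChar k 1 * ‖s u₀ v₀ k 1 2‖ ^ 2 +
      dChar k 2 * ‖s u₀ v₀ k 2 2‖ ^ 2 = dChar k 2 := by
  have h := congrFun (congrFun (conjTranspose_s_mul_diagonal_mul_s u₀ v₀ hk) 2) 2
  have h2 : ∀ z : ℂ, ∀ d : ℝ, star z * (d : ℂ) * z = ((d * ‖z‖ ^ 2 : ℝ) : ℂ) := fun z d => by
    rw [Complex.ofReal_mul, ← Complex.normSq_eq_norm_sq, ← Complex.mul_conj, Complex.star_def]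
    ring
  rw [Matrix.mul_apply, Fin.sum_univ_three] at h
  simp only [Matrix.mul_diagonal, Matrix.conjTranspose_apply, h2, Matrix.diagonal_apply_eq] at h
  exact_mod_cast h

theorem om_pow_six : om ^ 6 = 1 := by
  rw [show 6 = 3 * 2 from rfl, pow_mul, om_pow_three, one_pow]

theorem om_mul_mem (hk : k ∈ circle \ Q) : om * k ∈ circle \ Q := by
  refine ⟨?_, fun h => hk.2 ?_⟩
  · rw [mem_circle, norm_mul, norm_om, one_mul, mem_circle.1 hk.1]
  · change (om * k) ^ 6 = 1 at h
    rwa [mul_pow, om_pow_six, one_mul] at h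

theorem om_sq_mul_mem (hk : k ∈ circle \ Q) : om ^ 2 * k ∈ circle \ Q := by
  rw [sq, mul_assoc]
  exact om_mul_mem (om_mul_mem hk)

theorem om_div_mem (hk : k ∈ circle \ Q) : om / k ∈ circle \ Q := by
  refine ⟨?_, fun h => hk.2 ?_⟩
  · rw [mem_circle, norm_div, norm_om, mem_circle.1 hk.1, div_one]
  · change (om / k) ^ 6 = 1 at h
    rwa [div_pow, om_pow_six, one_div, inv_eq_one] at h

/-- Each l is a function of z + 1/z with z = ω^a k. Replacing k by ω/k turns ω^a k into the inverse
of ω^b k with a + b + 1 divisible by 3, which exchanges the second and third exponents. -/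
theorem ell_om_div (k : ℂ) (j : Fin 3) : ell j (om / k) = ell (Equiv.swap 1 2 j) k := by
  have h3 := om_pow_three
  have key : ∀ a b : ℕ, om ^ (a + 1) * om ^ b = 1 →
      om ^ a * (om / k) + (om ^ a * (om / k))⁻¹ = om ^ b * k + (om ^ b * k)⁻¹ := by
    intro a b hab
    have h : om ^ a * (om / k) = (om ^ b * k)⁻¹ := by
      rw [mul_inv, ← eq_inv_of_mul_eq_one_left hab, pow_succ]
      ring
    rw [h, inv_inv, add_comm]
  rw [ell, ell]
  congr 2
  fin_cases j
  · exact key 1 1 (by rw [← pow_add]; exact h3)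
  · exact key 2 3 (by rw [← pow_add]; exact om_pow_six)
  · exact key 3 2 (by rw [← pow_add]; exact om_pow_six)

theorem ell_om_sq_mul (k : ℂ) (j : Fin 3) :
    ell j (om ^ 2 * k) = ell (Equiv.addRight 2 j) k := by
  have key : ∀ a b : ℕ, om ^ (a + 2) = om ^ b → om ^ a * (om ^ 2 * k) = om ^ b * k := by
    intro a b hab
    rw [← hab, pow_add, mul_assoc]
  have h : om ^ ((j : ℕ) + 1) * (om ^ 2 * k) = om ^ (((Equiv.addRight 2 j : Fin 3) : ℕ) + 1) * k := by
    fin_cases j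
    · exact key 1 3 rfl
    · exact key 2 1 (by rw [show 2 + 2 = 3 + 1 from rfl, pow_succ, om_pow_three, one_mul, pow_one])
    · exact key 3 2 (by rw [pow_add, om_pow_three, one_mul])
  rw [ell, ell, h]

theorem s_om_div (u₀ v₀ : SchwartzMap ℝ ℝ) (hk : k ∈ circle \ Q) (i j : Fin 3) :
    s u₀ v₀ (om / k) i j = s u₀ v₀ k (Equiv.swap 1 2 i) (Equiv.swap 1 2 j) :=
  s_symm u₀ v₀ hk (om_div_mem hk) (ell_om_div k) i j

theorem sA_om_div (u₀ v₀ : SchwartzMap ℝ ℝ) (hk : k ∈ circle \ Q) (i j : Fin 3) :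
    sA u₀ v₀ (om / k) i j = sA u₀ v₀ k (Equiv.swap 1 2 i) (Equiv.swap 1 2 j) :=
  sA_symm u₀ v₀ hk (om_div_mem hk) (ell_om_div k) i j

theorem s_om_sq_mul (u₀ v₀ : SchwartzMap ℝ ℝ) (hk : k ∈ circle \ Q) :
    s u₀ v₀ (om ^ 2 * k) 0 0 = s u₀ v₀ k 2 2 :=
  s_symm u₀ v₀ hk (om_sq_mul_mem hk) (ell_om_sq_mul k) 0 0

theorem s_om_div_zero_zero (u₀ v₀ : SchwartzMap ℝ ℝ) (hk : k ∈ circle \ Q) :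
    s u₀ v₀ (om / k) 0 0 = s u₀ v₀ k 0 0 := s_om_div u₀ v₀ hk 0 0

theorem s_om_div_zero_one (u₀ v₀ : SchwartzMap ℝ ℝ) (hk : k ∈ circle \ Q) :
    s u₀ v₀ (om / k) 0 1 = s u₀ v₀ k 0 2 := s_om_div u₀ v₀ hk 0 1

theorem sA_om_div_zero_zero (u₀ v₀ : SchwartzMap ℝ ℝ) (hk : k ∈ circle \ Q) :
    sA u₀ v₀ (om / k) 0 0 = sA u₀ v₀ k 0 0 := sA_om_div u₀ v₀ hk 0 0

theorem sA_om_div_zero_one (u₀ v₀ : SchwartzMap ℝ ℝ) (hk : k ∈ circle \ Q) :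
    sA u₀ v₀ (om / k) 0 1 = sA u₀ v₀ k 0 2 := sA_om_div u₀ v₀ hk 0 1

/-! ### Real formulas for 1 + r₁r₂ and f -/

/-- The real-valued expression for `1 + r₁ r₂` away from the sixth roots of unity. -/
def wReal (u₀ v₀ : SchwartzMap ℝ ℝ) (k : ℂ) : ℝ :=
  1 + dChar k 0 / dChar k 1 * ‖s u₀ v₀ k 0 1‖ ^ 2 / ‖s u₀ v₀ k 0 0‖ ^ 2

open Classical in
/-- The real-valued expression for `f` away from the sixth roots of unity. -/
def fReal (u₀ v₀ : SchwartzMap ℝ ℝ) (k : ℂ) : ℝ :=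
  if s u₀ v₀ k 0 0 = 0 then 1 else 1 / ‖s u₀ v₀ k 0 0‖ ^ 2

theorem fReal_pos (u₀ v₀ : SchwartzMap ℝ ℝ) (k : ℂ) : 0 < fReal u₀ v₀ k := by
  rw [fReal]
  split_ifs with h
  · exact one_pos
  · have := norm_pos_iff.2 h
    positivity

theorem circleExt_of_notMem {g : ℂ → ℂ} (hk : k ∉ Q) : circleExt g k = g k := if_neg hk

theorem div_mul_div_eq (u₀ v₀ : SchwartzMap ℝ ℝ) (hk : k ∈ circle \ Q) (j : Fin 3) :
    s u₀ v₀ k 0 j / s u₀ v₀ k 0 0 * (sA u₀ v₀ k 0 j / sA u₀ v₀ k 0 0) =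
      ((dChar k 0 / dChar k j * ‖s u₀ v₀ k 0 j‖ ^ 2 / ‖s u₀ v₀ k 0 0‖ ^ 2 : ℝ) : ℂ) := by
  rw [div_mul_div_comm, s_mul_sA u₀ v₀ hk, s_mul_sA u₀ v₀ hk, div_self (dChar_ne_zero hk 0),
    one_mul, ← Complex.ofReal_div]

theorem r1_mul_r2 (u₀ v₀ : SchwartzMap ℝ ℝ) (hk : k ∈ circle \ Q) :
    r1 u₀ v₀ k * r2 u₀ v₀ k =
      ((dChar k 0 / dChar k 1 * ‖s u₀ v₀ k 0 1‖ ^ 2 / ‖s u₀ v₀ k 0 0‖ ^ 2 : ℝ) : ℂ) := by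
  rw [r1, r2, circleExt_of_notMem hk.2, circleExt_of_notMem hk.2, r1Raw, r2Raw,
    div_mul_div_eq u₀ v₀ hk]

theorem r1_mul_r2_om_div (u₀ v₀ : SchwartzMap ℝ ℝ) (hk : k ∈ circle \ Q) :
    r1 u₀ v₀ (om / k) * r2 u₀ v₀ (om / k) =
      ((dChar k 0 / dChar k 2 * ‖s u₀ v₀ k 0 2‖ ^ 2 / ‖s u₀ v₀ k 0 0‖ ^ 2 : ℝ) : ℂ) := by
  have hk' := om_div_mem hk
  rw [r1, r2, circleExt_of_notMem hk'.2, circleExt_of_notMem hk'.2, r1Raw, r2Raw,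
    s_om_div_zero_zero u₀ v₀ hk, s_om_div_zero_one u₀ v₀ hk, sA_om_div_zero_zero u₀ v₀ hk,
    sA_om_div_zero_one u₀ v₀ hk, div_mul_div_eq u₀ v₀ hk]

theorem one_add_r1_mul_r2 (u₀ v₀ : SchwartzMap ℝ ℝ) (hk : k ∈ circle \ Q) :
    1 + r1 u₀ v₀ k * r2 u₀ v₀ k = (wReal u₀ v₀ k : ℂ) := by
  rw [r1_mul_r2 u₀ v₀ hk, wReal]
  push_cast
  rfl

theorem fReal_eq (u₀ v₀ : SchwartzMap ℝ ℝ) (hk : k ∈ circle \ Q) :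
    fReal u₀ v₀ k = wReal u₀ v₀ k +
      dChar k 0 / dChar k 2 * ‖s u₀ v₀ k 0 2‖ ^ 2 / ‖s u₀ v₀ k 0 0‖ ^ 2 := by
  rw [fReal, wReal]
  split_ifs with h
  -- With s₁₁ = 0 every quotient by it is 0, and both sides equal 1.
  · simp [h]
  · have h0 : ‖s u₀ v₀ k 0 0‖ ^ 2 ≠ 0 := pow_ne_zero _ (norm_ne_zero_iff.2 h)
    rw [div_eq_iff h0, add_mul, add_mul, div_mul_cancel₀ _ h0, div_mul_cancel₀ _ h0, one_mul]
    exact (row_identity u₀ v₀ hk).symm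

theorem fRaw_eq (u₀ v₀ : SchwartzMap ℝ ℝ) (hk : k ∈ circle \ Q) :
    fRaw u₀ v₀ k = (fReal u₀ v₀ k : ℂ) := by
  have h : 1 / (om ^ 2 * k) = om / k := by
    rw [← om_inv]
    field_simp [om_ne_zero]
  rw [fRaw, h, r1_mul_r2_om_div u₀ v₀ hk, one_add_r1_mul_r2 u₀ v₀ hk, fReal_eq u₀ v₀ hk,
    Complex.ofReal_add]

theorem f_eq (u₀ v₀ : SchwartzMap ℝ ℝ) (hk : k ∈ circle \ Q) :
    f u₀ v₀ k = (fReal u₀ v₀ k : ℂ) := by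
  rw [f, circleExt_of_notMem hk.2, fRaw_eq u₀ v₀ hk]

/-! ### Limits at the sixth roots of unity -/

theorem Q_subset_circle : Q ⊆ circle := fun k hk => by
  rw [mem_circle]
  exact (pow_eq_one_iff_of_nonneg (norm_nonneg _) (by norm_num : 6 ≠ 0)).1
    (by rw [← norm_pow, show k ^ 6 = 1 from hk, norm_one])

theorem mem_Q_cases (hk : k ∈ Q) : k ∈ ({1, -1, om, -om} : Set ℂ) ∨ k = om ^ 2 ∨ k = -om ^ 2 := by
  have h : (k - 1) * (k + 1) * (k - om) * (k + om) * (k - om ^ 2) * (k + om ^ 2) = 0 := by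
    have h6 : k ^ 6 = 1 := hk
    have h1 := one_add_om_add_sq
    have h3 := om_pow_three
    have e2 : om ^ 2 = -1 - om := by linear_combination h1
    calc _ = (k ^ 2 - 1) * (k ^ 4 - (om ^ 2 + om ^ 3 * om) * k ^ 2 + (om ^ 3) ^ 2) := by ring
      _ = (k ^ 2 - 1) * (k ^ 4 + k ^ 2 + 1) := by rw [h3, e2]; ring
      _ = k ^ 6 - 1 := by ring
      _ = 0 := by rw [h6, sub_self]
  simp only [mul_eq_zero, sub_eq_zero, ← eq_neg_iff_add_eq_zero] at h
  simp only [Set.mem_insert_iff, Set.mem_singleton_iff]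
  tauto

theorem neBot_nhdsWithin_circle {κ : ℂ} (hκ : κ ∈ Q) : (𝓝[circle \ Q] κ).NeBot := by
  have ht : Tendsto (fun t : ℝ => κ * Complex.exp (t * Complex.I)) (𝓝[>] 0) (𝓝[circle \ Q] κ) := by
    refine tendsto_nhdsWithin_iff.2 ⟨?_, ?_⟩
    · have hc : Continuous fun t : ℝ => κ * Complex.exp (t * Complex.I) := by fun_prop
      have := (hc.tendsto 0).mono_left (nhdsWithin_le_nhds (s := Set.Ioi 0))
      simpa using this
    -- The range 0 < t < 1 avoids Q: the sixth power of κe^{it} is e^{6it}, and 6 < 2π.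
    · filter_upwards [Ioo_mem_nhdsGT (zero_lt_one' ℝ)] with t ht
      refine ⟨?_, fun h => ?_⟩
      · rw [mem_circle, norm_mul, Complex.norm_exp_ofReal_mul_I, mul_one]
        exact mem_circle.1 (Q_subset_circle hκ)
      · change (κ * Complex.exp (t * Complex.I)) ^ 6 = 1 at h
        rw [mul_pow, show κ ^ 6 = 1 from hκ, one_mul, ← Complex.exp_nat_mul,
          Complex.exp_eq_one_iff] at h
        obtain ⟨n, hn⟩ := h
        have h2 : (6 * t : ℂ) = ((n * (2 * Real.pi) : ℝ) : ℂ) := by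
          apply mul_right_cancel₀ Complex.I_ne_zero
          push_cast at hn ⊢
          linear_combination hn
        have h3 : 6 * t = n * (2 * Real.pi) := by exact_mod_cast h2
        have hpi := Real.pi_gt_three
        have h4 : (0 : ℝ) < n := by
          by_contra hneg
          nlinarith [ht.1]
        have h5 : (n : ℝ) < 1 := by
          by_contra hneg
          nlinarith [ht.2]
        have h6 : (0 : ℤ) < n := by exact_mod_cast h4
        have h7 : n < (1 : ℤ) := by exact_mod_cast h5
        omega
  exact ht.neBot

theorem circleExt_eq_of_tendsto {g : ℂ → ℂ} {κ c : ℂ} (hκ : κ ∈ Q)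
    (h : Tendsto g (𝓝[circle \ Q] κ) (𝓝 c)) : circleExt g κ = c := by
  have := neBot_nhdsWithin_circle hκ
  rw [circleExt, if_pos hκ, h.limUnder_eq]

theorem tendsto_om_mul (κ : ℂ) :
    Tendsto (fun k => om * k) (𝓝[circle \ Q] κ) (𝓝[circle \ Q] (om * κ)) :=
  tendsto_nhdsWithin_iff.2 ⟨((continuous_const.mul continuous_id).tendsto κ).mono_left
    nhdsWithin_le_nhds, eventually_mem_nhdsWithin.mono fun _ hk => om_mul_mem hk⟩

theorem tendsto_om_div {κ : ℂ} (hκ : κ ≠ 0) :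
    Tendsto (fun k => om / k) (𝓝[circle \ Q] κ) (𝓝[circle \ Q] (om / κ)) :=
  tendsto_nhdsWithin_iff.2 ⟨((continuousAt_const.div continuousAt_id hκ).tendsto).mono_left
    nhdsWithin_le_nhds, eventually_mem_nhdsWithin.mono fun _ hk => om_div_mem hk⟩

theorem om_div_om_div (k : ℂ) : om / (om / k) = k := div_div_cancel₀ om_ne_zero

theorem fReal_om_div (u₀ v₀ : SchwartzMap ℝ ℝ) (hk : k ∈ circle \ Q) :
    fReal u₀ v₀ (om / k) = fReal u₀ v₀ k := by
  rw [fReal, fReal, s_om_div_zero_zero u₀ v₀ hk]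

theorem sub_ne_zero_of_mem {ε : ℂ} (hε : ε ∈ Q) (hk : k ∈ circle \ Q) : k - ε ≠ 0 :=
  sub_ne_zero.2 fun h => hk.2 (h ▸ hε)

theorem tendsto_sub_nhdsWithin (ε : ℂ) :
    Tendsto (fun k : ℂ => k - ε) (𝓝[circle \ Q] ε) (𝓝 0) := by
  have h : Tendsto (fun k : ℂ => k - ε) (𝓝 ε) (𝓝 (ε - ε)) :=
    (continuous_id.sub continuous_const).tendsto ε
  rw [sub_self] at h
  exact h.mono_left nhdsWithin_le_nhds

/-- Near ε, f = |k − ε|² / |(k − ε) s₁₁|², and the denominator has a nonzero limit. -/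
theorem tendsto_fRaw_of_generic {ε : ℂ} (hε : ε ∈ Q) (hg : GenericAt u₀ v₀ ε) :
    Tendsto (fRaw u₀ v₀) (𝓝[circle \ Q] ε) (𝓝 0) := by
  obtain ⟨c, hc, h⟩ := hg.1
  have h1 : Tendsto (fun k => ((‖k - ε‖ ^ 2 / ‖(k - ε) * s u₀ v₀ k 0 0‖ ^ 2 : ℝ) : ℂ))
      (𝓝[circle \ Q] ε) (𝓝 ((‖(0 : ℂ)‖ ^ 2 / ‖c‖ ^ 2 : ℝ) : ℂ)) :=
    (Complex.continuous_ofReal.tendsto _).comp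
      (((tendsto_sub_nhdsWithin ε).norm.pow 2).div (h.norm.pow 2)
        (pow_ne_zero _ (norm_ne_zero_iff.2 hc)))
  simp only [norm_zero, ne_eq, OfNat.ofNat_ne_zero, not_false_eq_true, zero_pow, zero_div,
    Complex.ofReal_zero] at h1
  refine h1.congr' ?_
  filter_upwards [eventually_mem_nhdsWithin, h.eventually_ne hc] with k hk hne
  have h2 := sub_ne_zero_of_mem hε hk
  rw [fRaw_eq u₀ v₀ hk, fReal, if_neg (right_ne_zero_of_mul hne), norm_mul, mul_pow,
    div_mul_eq_div_div, div_self (pow_ne_zero _ (norm_ne_zero_iff.2 h2))]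

theorem tendsto_fRaw_of_generic_om_div {ε κ : ℂ} (hε : ε ∈ Q) (hκ : κ ≠ 0) (h : om / κ = ε)
    (hg : GenericAt u₀ v₀ ε) : Tendsto (fRaw u₀ v₀) (𝓝[circle \ Q] κ) (𝓝 0) := by
  have ht := tendsto_om_div hκ
  rw [h] at ht
  refine ((tendsto_fRaw_of_generic hε hg).comp ht).congr' ?_
  filter_upwards [eventually_mem_nhdsWithin] with k hk
  rw [Function.comp_apply, fRaw_eq u₀ v₀ hk, fRaw_eq u₀ v₀ (om_div_mem hk),
    fReal_om_div u₀ v₀ hk]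

/-- Here s₁₁(k) = s₃₃(ωk), and s₃₃ has a nonzero limit at ε. This covers ±ω², where r₂ may be
unbounded. -/
theorem tendsto_fRaw_of_generic_om_mul {ε κ : ℂ} (h : om * κ = ε) (hg : GenericAt u₀ v₀ ε) :
    ∃ a : ℝ, 0 < a ∧ Tendsto (fRaw u₀ v₀) (𝓝[circle \ Q] κ) (𝓝 (a : ℂ)) := by
  obtain ⟨c, hc, hs⟩ := hg.2.2.2.1
  have hc' := norm_pos_iff.2 hc
  refine ⟨1 / ‖c‖ ^ 2, by positivity, ?_⟩
  have ht := tendsto_om_mul κ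
  rw [h] at ht
  have hs' := hs.comp ht
  refine ((Complex.continuous_ofReal.tendsto _).comp
    ((tendsto_const_nhds (x := (1 : ℝ))).div (hs'.norm.pow 2) (pow_ne_zero _ hc'.ne'))).congr' ?_
  filter_upwards [eventually_mem_nhdsWithin, hs'.eventually_ne hc] with k hk hne
  have h1 : s u₀ v₀ k 0 0 = s u₀ v₀ (om * k) 2 2 := by
    rw [← s_om_sq_mul u₀ v₀ (om_mul_mem hk), ← mul_assoc, ← pow_succ, om_pow_three, one_mul]
  rw [Function.comp_apply] at hne
  rw [fRaw_eq u₀ v₀ hk, fReal, h1, if_neg hne]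
  rfl

/-- The involution turns r₁ and r₂ at κ into s₁₃/s₁₁ and s^A₁₃/s^A₁₁ at ε. In the first, numerator
and denominator are both of order 1/(k − ε); in the second only the denominator is, hence the limit
0. -/
theorem tendsto_rRaw_of_generic {ε κ : ℂ} (hε : ε ∈ Q) (hκ : κ ≠ 0) (h : om / κ = ε)
    (hg : GenericAt u₀ v₀ ε) :
    (∃ c, Tendsto (r1Raw u₀ v₀) (𝓝[circle \ Q] κ) (𝓝 c)) ∧
      Tendsto (r2Raw u₀ v₀) (𝓝[circle \ Q] κ) (𝓝 0) := by
  obtain ⟨⟨a, ha, hsa⟩, ⟨b, -, hsb⟩, -, -, ⟨c, hc, hsc⟩, -, ⟨d, -, hsd⟩, -⟩ := hg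
  have ht := tendsto_om_div hκ
  rw [h] at ht
  refine ⟨⟨b / a, ((hsb.div hsa ha).comp ht).congr' ?_⟩, ?_⟩
  · filter_upwards [eventually_mem_nhdsWithin] with k hk
    have hk' := om_div_mem hk
    have h2 := sub_ne_zero_of_mem hε hk'
    simp only [Function.comp_apply, Pi.div_apply]
    rw [mul_div_mul_left _ _ h2, r1Raw, s_om_div_zero_zero u₀ v₀ hk,
      ← s_om_div_zero_one u₀ v₀ hk', om_div_om_div]
  · have h0 := (((tendsto_sub_nhdsWithin ε).mul hsd).div hsc hc).comp ht
    rw [zero_mul, zero_div] at h0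
    refine h0.congr' ?_
    filter_upwards [eventually_mem_nhdsWithin] with k hk
    have hk' := om_div_mem hk
    have h2 := sub_ne_zero_of_mem hε hk'
    simp only [Function.comp_apply, Pi.div_apply]
    rw [mul_div_mul_left _ _ h2, r2Raw, sA_om_div_zero_zero u₀ v₀ hk,
      ← sA_om_div_zero_one u₀ v₀ hk', om_div_om_div]

/-! ### Arcs of the circle and the order of the exponents -/

theorem sin_pos_of_shift (n : ℤ) {x : ℝ} (h1 : n * (2 * Real.pi) < x)
    (h2 : x < n * (2 * Real.pi) + Real.pi) : 0 < Real.sin x := by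
  rw [← Real.sin_sub_int_mul_two_pi x n]
  exact Real.sin_pos_of_pos_of_lt_pi (by linarith) (by linarith)

theorem sin_neg_of_shift (n : ℤ) {x : ℝ} (h1 : n * (2 * Real.pi) - Real.pi < x)
    (h2 : x < n * (2 * Real.pi)) : Real.sin x < 0 := by
  rw [← Real.sin_sub_int_mul_two_pi x n]
  exact Real.sin_neg_of_neg_of_neg_pi_lt (by linarith) (by linarith)

theorem om_eq_exp : om = Complex.exp (((2 * Real.pi / 3 : ℝ) : ℂ) * Complex.I) := by
  rw [om]
  congr 1
  push_cast
  ring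

theorem om_mul_exp (θ : ℝ) : om * Complex.exp (θ * Complex.I) =
    Complex.exp (((θ + 2 * Real.pi / 3 : ℝ) : ℂ) * Complex.I) := by
  rw [om_eq_exp, ← Complex.exp_add]
  congr 1
  push_cast
  ring

theorem om_sq_mul_exp (θ : ℝ) : om ^ 2 * Complex.exp (θ * Complex.I) =
    Complex.exp (((θ + 4 * Real.pi / 3 : ℝ) : ℂ) * Complex.I) := by
  rw [sq, mul_assoc, om_mul_exp, om_mul_exp]
  congr 3
  ring

theorem exp_sub_two_pi (θ : ℝ) : Complex.exp (((θ - 2 * Real.pi : ℝ) : ℂ) * Complex.I) =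
    Complex.exp (θ * Complex.I) := by
  have : (((θ - 2 * Real.pi : ℝ) : ℂ) * Complex.I) = θ * Complex.I - 2 * Real.pi * Complex.I := by
    push_cast
    ring
  rw [this, Complex.exp_periodic.sub_eq]

theorem om_mul_mem_arc {a b : ℝ} (hk : k ∈ arc a b) :
    om * k ∈ arc (a + 2 * Real.pi / 3) (b + 2 * Real.pi / 3) := by
  obtain ⟨θ, hθ, rfl⟩ := hk
  exact ⟨_, ⟨by linarith [hθ.1], by linarith [hθ.2]⟩, om_mul_exp θ⟩

theorem arc_sub_two_pi {a b : ℝ} (hk : k ∈ arc a b) :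
    k ∈ arc (a - 2 * Real.pi) (b - 2 * Real.pi) := by
  obtain ⟨θ, hθ, rfl⟩ := hk
  exact ⟨θ - 2 * Real.pi, ⟨by linarith [hθ.1], by linarith [hθ.2]⟩, (exp_sub_two_pi θ).symm⟩

theorem mem_circle_of_mem_arc {a b : ℝ} (hk : k ∈ arc a b) : k ∈ circle := by
  obtain ⟨θ, -, rfl⟩ := hk
  rw [mem_circle, Complex.norm_exp_ofReal_mul_I]

theorem mem_circle_diff_Q_of_im (hk : k ∈ circle) (h1 : k.im ≠ 0) (h2 : (om * k).im ≠ 0)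
    (h3 : (om ^ 2 * k).im ≠ 0) : k ∈ circle \ Q :=
  ⟨hk, fun h => mul_ne_zero (mul_ne_zero h1 h2) h3 ((mem_Q_iff hk).1 h)⟩

/-- On these arcs `l₁` lies between `l₂` and `l₃`. -/
theorem dChar_sign_of_mem_arc_first (hk : k ∈ arc (2 * Real.pi / 3) Real.pi ∪
    arc (5 * Real.pi / 3) (2 * Real.pi)) :
    k ∈ circle \ Q ∧ 0 < dChar k 0 ∧ dChar k 1 < 0 ∧ dChar k 2 < 0 := by
  have hpi := Real.pi_pos
  rcases hk with hk | hk
  · have hc := mem_circle_of_mem_arc hk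
    obtain ⟨θ, ⟨h1, h2⟩, rfl⟩ := hk
    set k := Complex.exp (θ * Complex.I) with hkdef
    have e1 : 0 < k.im := by
      rw [hkdef, Complex.exp_ofReal_mul_I_im]
      exact sin_pos_of_shift 0 (by push_cast; linarith) (by push_cast; linarith)
    have e2 : (om * k).im < 0 := by
      rw [hkdef, om_mul_exp, Complex.exp_ofReal_mul_I_im]
      exact sin_neg_of_shift 1 (by push_cast; linarith) (by push_cast; linarith)
    have e3 : 0 < (om ^ 2 * k).im := by
      rw [hkdef, om_sq_mul_exp, Complex.exp_ofReal_mul_I_im]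
      exact sin_pos_of_shift 1 (by push_cast; linarith) (by push_cast; linarith)
    exact ⟨mem_circle_diff_Q_of_im hc e1.ne' e2.ne e3.ne', mul_pos e1 e3,
      mul_neg_of_pos_of_neg e1 e2, mul_neg_of_neg_of_pos e2 e3⟩
  · have hc := mem_circle_of_mem_arc hk
    obtain ⟨θ, ⟨h1, h2⟩, rfl⟩ := hk
    set k := Complex.exp (θ * Complex.I) with hkdef
    have e1 : k.im < 0 := by
      rw [hkdef, Complex.exp_ofReal_mul_I_im]
      exact sin_neg_of_shift 1 (by push_cast; linarith) (by push_cast; linarith)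
    have e2 : 0 < (om * k).im := by
      rw [hkdef, om_mul_exp, Complex.exp_ofReal_mul_I_im]
      exact sin_pos_of_shift 1 (by push_cast; linarith) (by push_cast; linarith)
    have e3 : (om ^ 2 * k).im < 0 := by
      rw [hkdef, om_sq_mul_exp, Complex.exp_ofReal_mul_I_im]
      exact sin_neg_of_shift 2 (by push_cast; linarith) (by push_cast; linarith)
    exact ⟨mem_circle_diff_Q_of_im hc e1.ne e2.ne' e3.ne, mul_pos_of_neg_of_neg e1 e3,
      mul_neg_of_neg_of_pos e1 e2, mul_neg_of_pos_of_neg e2 e3⟩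

/-- On these arcs `l₃` lies between `l₁` and `l₂`. -/
theorem dChar_sign_of_mem_arc_third (hk : k ∈ arc (Real.pi / 3) (2 * Real.pi / 3) ∪
    arc (4 * Real.pi / 3) (5 * Real.pi / 3)) :
    k ∈ circle \ Q ∧ dChar k 0 < 0 ∧ dChar k 1 < 0 ∧ 0 < dChar k 2 := by
  have hpi := Real.pi_pos
  rcases hk with hk | hk
  · have hc := mem_circle_of_mem_arc hk
    obtain ⟨θ, ⟨h1, h2⟩, rfl⟩ := hk
    set k := Complex.exp (θ * Complex.I) with hkdef
    have e1 : 0 < k.im := by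
      rw [hkdef, Complex.exp_ofReal_mul_I_im]
      exact sin_pos_of_shift 0 (by push_cast; linarith) (by push_cast; linarith)
    have e2 : (om * k).im < 0 := by
      rw [hkdef, om_mul_exp, Complex.exp_ofReal_mul_I_im]
      exact sin_neg_of_shift 1 (by push_cast; linarith) (by push_cast; linarith)
    have e3 : (om ^ 2 * k).im < 0 := by
      rw [hkdef, om_sq_mul_exp, Complex.exp_ofReal_mul_I_im]
      exact sin_neg_of_shift 1 (by push_cast; linarith) (by push_cast; linarith)
    exact ⟨mem_circle_diff_Q_of_im hc e1.ne' e2.ne e3.ne, mul_neg_of_pos_of_neg e1 e3,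
      mul_neg_of_pos_of_neg e1 e2, mul_pos_of_neg_of_neg e2 e3⟩
  · have hc := mem_circle_of_mem_arc hk
    obtain ⟨θ, ⟨h1, h2⟩, rfl⟩ := hk
    set k := Complex.exp (θ * Complex.I) with hkdef
    have e1 : k.im < 0 := by
      rw [hkdef, Complex.exp_ofReal_mul_I_im]
      exact sin_neg_of_shift 1 (by push_cast; linarith) (by push_cast; linarith)
    have e2 : 0 < (om * k).im := by
      rw [hkdef, om_mul_exp, Complex.exp_ofReal_mul_I_im]
      exact sin_pos_of_shift 1 (by push_cast; linarith) (by push_cast; linarith)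
    have e3 : 0 < (om ^ 2 * k).im := by
      rw [hkdef, om_sq_mul_exp, Complex.exp_ofReal_mul_I_im]
      exact sin_pos_of_shift 1 (by push_cast; linarith) (by push_cast; linarith)
    exact ⟨mem_circle_diff_Q_of_im hc e1.ne e2.ne' e3.ne', mul_neg_of_neg_of_pos e1 e3,
      mul_neg_of_neg_of_pos e1 e2, mul_pos e2 e3⟩

/-! ### Inequalities from the signs of the d_j -/

/-- Bounds for `1 + r₁ r₂` and `f` where `l₁` lies between `l₂` and `l₃`. -/
theorem bounds_of_first (u₀ v₀ : SchwartzMap ℝ ℝ) (hk : k ∈ circle \ Q) (h0 : 0 < dChar k 0)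
    (h1 : dChar k 1 < 0) (h2 : dChar k 2 < 0) :
    0 < wReal u₀ v₀ k ∧ wReal u₀ v₀ k ≤ 1 ∧ fReal u₀ v₀ k ≤ 1 := by
  have e1 : dChar k 0 / dChar k 1 * ‖s u₀ v₀ k 0 1‖ ^ 2 / ‖s u₀ v₀ k 0 0‖ ^ 2 ≤ 0 :=
    div_nonpos_of_nonpos_of_nonneg (mul_nonpos_of_nonpos_of_nonneg
      (div_neg_of_pos_of_neg h0 h1).le (by positivity)) (by positivity)
  have e2 : dChar k 0 / dChar k 2 * ‖s u₀ v₀ k 0 2‖ ^ 2 / ‖s u₀ v₀ k 0 0‖ ^ 2 ≤ 0 :=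
    div_nonpos_of_nonpos_of_nonneg (mul_nonpos_of_nonpos_of_nonneg
      (div_neg_of_pos_of_neg h0 h2).le (by positivity)) (by positivity)
  have h3 := fReal_eq u₀ v₀ hk
  have h4 := fReal_pos u₀ v₀ k
  have h5 : wReal u₀ v₀ k ≤ 1 := by
    rw [wReal]
    linarith
  exact ⟨by linarith, h5, by linarith⟩

/-- Bounds for `1 + r₁ r₂` and `f` where `l₃` lies between `l₁` and `l₂`. -/
theorem bounds_of_third (u₀ v₀ : SchwartzMap ℝ ℝ) (hk : k ∈ circle \ Q) (h0 : dChar k 0 < 0)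
    (h1 : dChar k 1 < 0) (h2 : 0 < dChar k 2) :
    1 ≤ wReal u₀ v₀ k ∧ fReal u₀ v₀ k ≤ wReal u₀ v₀ k := by
  have e1 : 0 ≤ dChar k 0 / dChar k 1 * ‖s u₀ v₀ k 0 1‖ ^ 2 / ‖s u₀ v₀ k 0 0‖ ^ 2 := by
    have := div_pos_of_neg_of_neg h0 h1
    positivity
  have e2 : dChar k 0 / dChar k 2 * ‖s u₀ v₀ k 0 2‖ ^ 2 / ‖s u₀ v₀ k 0 0‖ ^ 2 ≤ 0 :=
    div_nonpos_of_nonpos_of_nonneg (mul_nonpos_of_nonpos_of_nonneg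
      (div_neg_of_neg_of_pos h0 h2).le (by positivity)) (by positivity)
  have h3 := fReal_eq u₀ v₀ hk
  refine ⟨?_, by linarith⟩
  rw [wReal]
  linarith

/-- With t = (d₁/d₃)|s₁₃|² ≤ 0, the row identity gives 1 + r₁r₂ = (1 − t)/|s₁₁|², while f(k) =
1/|s₁₁|² and f(ω²k) = 1/|s₃₃|². The claim thus reduces to |s₃₃|² ≥ 1 − t, which is the column
identity without its term in d₂, of favorable sign. -/
theorem wReal_mul_fReal_le (u₀ v₀ : SchwartzMap ℝ ℝ) (hk : k ∈ circle \ Q) (h0 : dChar k 0 < 0)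
    (h1 : dChar k 1 < 0) (h2 : 0 < dChar k 2) (hf : fReal u₀ v₀ (om ^ 2 * k) ≤ 1) :
    wReal u₀ v₀ k * fReal u₀ v₀ (om ^ 2 * k) ≤ fReal u₀ v₀ k := by
  by_cases hs : s u₀ v₀ k 0 0 = 0
  -- If s₁₁ = 0, the conventions for quotients make both functions equal to 1 at k, so the claim is
  -- `hf`.
  · have e1 : wReal u₀ v₀ k = 1 := by simp [wReal, hs]
    have e2 : fReal u₀ v₀ k = 1 := by simp [fReal, hs]
    rw [e1, e2, one_mul]
    exact hf
  have hrow := row_identity u₀ v₀ hk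
  have hcol := column_identity u₀ v₀ hk
  have hpos : 0 < ‖s u₀ v₀ k 0 0‖ ^ 2 := by
    have := norm_pos_iff.2 hs
    positivity
  set t := dChar k 0 / dChar k 2 * ‖s u₀ v₀ k 0 2‖ ^ 2 with ht
  have ht0 : t ≤ 0 := mul_nonpos_of_nonpos_of_nonneg (div_neg_of_neg_of_pos h0 h2).le
    (by positivity)
  have h22 : 1 - t ≤ ‖s u₀ v₀ k 2 2‖ ^ 2 := by
    have e : dChar k 2 * t = dChar k 0 * ‖s u₀ v₀ k 0 2‖ ^ 2 := by
      rw [ht]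
      field_simp
    have e2 : dChar k 1 * ‖s u₀ v₀ k 1 2‖ ^ 2 ≤ 0 :=
      mul_nonpos_of_nonpos_of_nonneg h1.le (by positivity)
    refine le_of_mul_le_mul_left ?_ h2
    linarith
  have h22' : 0 < ‖s u₀ v₀ k 2 2‖ ^ 2 := by linarith
  have h22n : s u₀ v₀ k 2 2 ≠ 0 := fun h => by simp [h] at h22'
  have hw : wReal u₀ v₀ k = (1 - t) / ‖s u₀ v₀ k 0 0‖ ^ 2 := by
    rw [wReal, eq_div_iff hpos.ne', add_mul, div_mul_cancel₀ _ hpos.ne']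
    linarith
  rw [fReal, fReal, s_om_sq_mul u₀ v₀ hk, if_neg hs, if_neg h22n, hw, div_mul_div_comm, mul_one,
    div_le_div_iff₀ (by positivity) hpos, one_mul, mul_comm]
  gcongr

theorem nuLog_ofReal {t : ℝ} (ht : 0 < t) :
    nuLog (t : ℂ) = ((-(1 / (2 * Real.pi)) * Real.log t : ℝ) : ℂ) := by
  rw [nuLog, ← Complex.ofReal_log ht.le]
  push_cast
  rfl

end Boussinesq

end

/-! ### Proof of the theorem -/

/-- Inequalities and strict inequalities between complex numbers (order of `ComplexOrder`) contain
the assertion that both sides have the same imaginary part; e.g. `0 ≤ z` says that `z` is real and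
nonnegative. -/
theorem lemma2p10 (u₀ v₀ : SchwartzMap ℝ ℝ)
    (hsol : Boussinesq.NoSolitons u₀ v₀)
    (hgen₁ : Boussinesq.GenericAt u₀ v₀ 1)
    (hgen₂ : Boussinesq.GenericAt u₀ v₀ (-1)) :
    -- The values of `f` at the sixth roots of unity, and those of `r₁`, `r₂` at `±ω`, are limits.
    (∀ κ ∈ Boussinesq.Q, Filter.Tendsto (Boussinesq.fRaw u₀ v₀)
      (nhdsWithin κ (Boussinesq.circle \ Boussinesq.Q)) (nhds (Boussinesq.f u₀ v₀ κ))) ∧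
    (∀ κ ∈ ({Boussinesq.om, -Boussinesq.om} : Set ℂ),
      Filter.Tendsto (Boussinesq.r1Raw u₀ v₀)
        (nhdsWithin κ (Boussinesq.circle \ Boussinesq.Q)) (nhds (Boussinesq.r1 u₀ v₀ κ)) ∧
      Filter.Tendsto (Boussinesq.r2Raw u₀ v₀)
        (nhdsWithin κ (Boussinesq.circle \ Boussinesq.Q)) (nhds (Boussinesq.r2 u₀ v₀ κ))) ∧
    -- The formula `f = 1 / |s₁₁|²`.
    (∀ k ∈ Boussinesq.circle \ Boussinesq.Q, Boussinesq.s u₀ v₀ k 0 0 ≠ 0 →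
      Boussinesq.f u₀ v₀ k = ((1 / ‖Boussinesq.s u₀ v₀ k 0 0‖ ^ 2 : ℝ) : ℂ)) ∧
    -- Assertion (i), in three parts.
    (∀ k ∈ Boussinesq.circle, 0 ≤ Boussinesq.f u₀ v₀ k) ∧
    (∀ k ∈ Boussinesq.circle, Boussinesq.f u₀ v₀ k = 0 ↔
      k ∈ ({1, -1, Boussinesq.om, -Boussinesq.om} : Set ℂ)) ∧
    (∀ k ∈ Boussinesq.arc (2 * Real.pi / 3) Real.pi ∪
        Boussinesq.arc (5 * Real.pi / 3) (2 * Real.pi), Boussinesq.f u₀ v₀ k ≤ 1) ∧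
    -- Assertion (ii).
    (∀ k ∈ Boussinesq.arc (Real.pi / 3) Real.pi ∪
        Boussinesq.arc (4 * Real.pi / 3) (2 * Real.pi),
      0 < 1 + Boussinesq.r1 u₀ v₀ k * Boussinesq.r2 u₀ v₀ k) ∧
    -- Assertion (iii).
    (∀ k ∈ Boussinesq.arc (5 * Real.pi / 3) (2 * Real.pi),
      0 ≤ Boussinesq.nuLog (1 + Boussinesq.r1 u₀ v₀ k * Boussinesq.r2 u₀ v₀ k)) ∧
    -- Assertion (iv).
    (∀ k ∈ Boussinesq.arc (5 * Real.pi / 3) (2 * Real.pi), 0 ≤ Boussinesq.nuHat1 u₀ v₀ k) ∧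
    (∀ k ∈ Boussinesq.arc Real.pi (4 * Real.pi / 3), 0 ≤ Boussinesq.nuHat2 u₀ v₀ k) := by
  have hpi := Real.pi_pos
  have hQ1 : (1 : ℂ) ∈ Boussinesq.Q := one_pow 6
  have hQ2 : (-1 : ℂ) ∈ Boussinesq.Q := by
    change (-1 : ℂ) ^ 6 = 1
    norm_num
  have hQo : Boussinesq.om ∈ Boussinesq.Q := Boussinesq.om_pow_six
  have hQo' : -Boussinesq.om ∈ Boussinesq.Q := by
    change (-Boussinesq.om) ^ 6 = 1
    rw [Even.neg_pow (by decide), Boussinesq.om_pow_six]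
  have hon : Boussinesq.om ≠ 0 := Boussinesq.om_ne_zero
  have hon' : -Boussinesq.om ≠ 0 := neg_ne_zero.2 hon
  have hod : Boussinesq.om / Boussinesq.om = 1 := div_self hon
  have hod' : Boussinesq.om / -Boussinesq.om = -1 := by rw [div_neg, div_self hon]
  have hzero : ∀ κ ∈ ({1, -1, Boussinesq.om, -Boussinesq.om} : Set ℂ),
      Filter.Tendsto (Boussinesq.fRaw u₀ v₀) (nhdsWithin κ (Boussinesq.circle \ Boussinesq.Q)) (nhds 0) := by
    rintro κ (rfl | rfl | rfl | rfl)
    exacts [Boussinesq.tendsto_fRaw_of_generic hQ1 hgen₁, Boussinesq.tendsto_fRaw_of_generic hQ2 hgen₂,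
      Boussinesq.tendsto_fRaw_of_generic_om_div hQ1 hon hod hgen₁,
      Boussinesq.tendsto_fRaw_of_generic_om_div hQ2 hon' hod' hgen₂]
  have hpos : ∀ κ, κ = Boussinesq.om ^ 2 ∨ κ = -Boussinesq.om ^ 2 → ∃ a : ℝ, 0 < a ∧
      Filter.Tendsto (Boussinesq.fRaw u₀ v₀) (nhdsWithin κ (Boussinesq.circle \ Boussinesq.Q)) (nhds (a : ℂ)) := by
    have h3 : Boussinesq.om * Boussinesq.om ^ 2 = 1 := by rw [← pow_succ', Boussinesq.om_pow_three]
    rintro κ (rfl | rfl)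
    · exact Boussinesq.tendsto_fRaw_of_generic_om_mul h3 hgen₁
    · exact Boussinesq.tendsto_fRaw_of_generic_om_mul (by rw [mul_neg, h3]) hgen₂
  have hfzero : ∀ κ ∈ ({1, -1, Boussinesq.om, -Boussinesq.om} : Set ℂ), Boussinesq.f u₀ v₀ κ = 0 := by
    intro κ hκ
    refine Boussinesq.circleExt_eq_of_tendsto ?_ (hzero κ hκ)
    rcases hκ with rfl | rfl | rfl | rfl
    exacts [hQ1, hQ2, hQo, hQo']
  have hfpos : ∀ κ ∈ Boussinesq.Q, κ = Boussinesq.om ^ 2 ∨ κ = -Boussinesq.om ^ 2 → 0 < Boussinesq.f u₀ v₀ κ := by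
    intro κ hκ h
    obtain ⟨a, ha, hlim⟩ := hpos κ h
    rw [Boussinesq.f, Boussinesq.circleExt_eq_of_tendsto hκ hlim]
    exact Complex.zero_lt_real.2 ha
  have hr : ∀ κ ∈ ({Boussinesq.om, -Boussinesq.om} : Set ℂ),
      (∃ c, Filter.Tendsto (Boussinesq.r1Raw u₀ v₀) (nhdsWithin κ (Boussinesq.circle \ Boussinesq.Q)) (nhds c)) ∧
        Filter.Tendsto (Boussinesq.r2Raw u₀ v₀) (nhdsWithin κ (Boussinesq.circle \ Boussinesq.Q)) (nhds 0) := by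
    rintro κ (rfl | rfl)
    exacts [Boussinesq.tendsto_rRaw_of_generic hQ1 hon hod hgen₁,
      Boussinesq.tendsto_rRaw_of_generic hQ2 hon' hod' hgen₂]
  have hQr : ∀ κ ∈ ({Boussinesq.om, -Boussinesq.om} : Set ℂ), κ ∈ Boussinesq.Q := by
    rintro κ (rfl | rfl)
    exacts [hQo, hQo']
  have hr2 : ∀ κ ∈ ({Boussinesq.om, -Boussinesq.om} : Set ℂ), Boussinesq.r2 u₀ v₀ κ = 0 := fun κ hκ =>
    Boussinesq.circleExt_eq_of_tendsto (hQr κ hκ) (hr κ hκ).2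
  have hthird : ∀ k ∈ Boussinesq.arc (Real.pi / 3) (2 * Real.pi / 3) ∪
      Boussinesq.arc (4 * Real.pi / 3) (5 * Real.pi / 3), 0 < 1 + Boussinesq.r1 u₀ v₀ k * Boussinesq.r2 u₀ v₀ k := by
    intro k hk
    obtain ⟨hkQ, h0, h1, h2⟩ := Boussinesq.dChar_sign_of_mem_arc_third hk
    rw [Boussinesq.one_add_r1_mul_r2 u₀ v₀ hkQ]
    exact Complex.zero_lt_real.2 (one_pos.trans_le (Boussinesq.bounds_of_third u₀ v₀ hkQ h0 h1 h2).1)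
  have hfirst : ∀ k ∈ Boussinesq.arc (2 * Real.pi / 3) Real.pi ∪ Boussinesq.arc (5 * Real.pi / 3) (2 * Real.pi),
      0 < 1 + Boussinesq.r1 u₀ v₀ k * Boussinesq.r2 u₀ v₀ k := by
    intro k hk
    obtain ⟨hkQ, h0, h1, h2⟩ := Boussinesq.dChar_sign_of_mem_arc_first hk
    rw [Boussinesq.one_add_r1_mul_r2 u₀ v₀ hkQ]
    exact Complex.zero_lt_real.2 (Boussinesq.bounds_of_first u₀ v₀ hkQ h0 h1 h2).1
  refine ⟨?_, ?_, ?_, ?_, ?_, ?_, ?_, ?_, ?_, ?_⟩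
  · intro κ hκ
    rcases Boussinesq.mem_Q_cases hκ with h | h
    · rw [hfzero κ h]
      exact hzero κ h
    · obtain ⟨a, ha, hlim⟩ := hpos κ h
      rw [Boussinesq.f, Boussinesq.circleExt_eq_of_tendsto hκ hlim]
      exact hlim
  · intro κ hκ
    obtain ⟨⟨c, hc⟩, h2⟩ := hr κ hκ
    rw [hr2 κ hκ, Boussinesq.r1, Boussinesq.circleExt_eq_of_tendsto (hQr κ hκ) hc]
    exact ⟨hc, h2⟩
  · intro k hk hs
    rw [Boussinesq.f_eq u₀ v₀ hk, Boussinesq.fReal, if_neg hs]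
  · intro k hk
    by_cases hkQ : k ∈ Boussinesq.Q
    · rcases Boussinesq.mem_Q_cases hkQ with h | h
      · exact (hfzero k h).ge
      · exact (hfpos k hkQ h).le
    · rw [Boussinesq.f_eq u₀ v₀ ⟨hk, hkQ⟩]
      exact Complex.zero_le_real.2 (Boussinesq.fReal_pos u₀ v₀ k).le
  · intro k hk
    refine ⟨fun h => ?_, hfzero k⟩
    by_cases hkQ : k ∈ Boussinesq.Q
    · rcases Boussinesq.mem_Q_cases hkQ with h' | h'
      · exact h'
      · exact absurd h (hfpos k hkQ h').ne'
    · rw [Boussinesq.f_eq u₀ v₀ ⟨hk, hkQ⟩, Complex.ofReal_eq_zero] at h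
      exact absurd h (Boussinesq.fReal_pos u₀ v₀ k).ne'
  · intro k hk
    obtain ⟨hkQ, h0, h1, h2⟩ := Boussinesq.dChar_sign_of_mem_arc_first hk
    rw [Boussinesq.f_eq u₀ v₀ hkQ]
    exact_mod_cast (Boussinesq.bounds_of_first u₀ v₀ hkQ h0 h1 h2).2.2
  · rintro k (⟨θ, ⟨h1, h2⟩, hk⟩ | ⟨θ, ⟨h1, h2⟩, hk⟩)
    · rcases lt_trichotomy θ (2 * Real.pi / 3) with h | h | h
      · exact hthird k (Or.inl ⟨θ, ⟨h1, h⟩, hk⟩)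
      -- The two subarcs meet at ω, a point of Q. There r₂ has the limit 0, so the expression is 1;
      -- likewise at −ω below.
      · have : k = Boussinesq.om := by rw [hk, h, Boussinesq.om_eq_exp]
        rw [this, hr2 Boussinesq.om (Or.inl rfl), mul_zero, add_zero]
        exact one_pos
      · exact hfirst k (Or.inl ⟨θ, ⟨h, h2⟩, hk⟩)
    · rcases lt_trichotomy θ (5 * Real.pi / 3) with h | h | h
      · exact hthird k (Or.inr ⟨θ, ⟨h1, h⟩, hk⟩)
      · have : k = -Boussinesq.om := by
          rw [hk, h, Boussinesq.om_eq_exp, show 5 * Real.pi / 3 = 2 * Real.pi / 3 + Real.pi by ring,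
            Complex.ofReal_add, add_mul, Complex.exp_add, Complex.exp_pi_mul_I, mul_neg_one]
        rw [this, hr2 (-Boussinesq.om) (Or.inr rfl), mul_zero, add_zero]
        exact one_pos
      · exact hfirst k (Or.inr ⟨θ, ⟨h, h2⟩, hk⟩)
  · intro k hk
    obtain ⟨hkQ, h0, h1, h2⟩ := Boussinesq.dChar_sign_of_mem_arc_first (Or.inr hk)
    obtain ⟨hw0, hw1, -⟩ := Boussinesq.bounds_of_first u₀ v₀ hkQ h0 h1 h2
    rw [Boussinesq.one_add_r1_mul_r2 u₀ v₀ hkQ, Boussinesq.nuLog_ofReal hw0]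
    refine Complex.zero_le_real.2 (mul_nonneg_of_nonpos_of_nonpos ?_ (Real.log_nonpos hw0.le hw1))
    exact neg_nonpos.2 (by positivity)
  · intro k hk
    -- Rotation by ω gives arguments in (7π/3, 8π/3), brought back by one full turn.
    have hk' : Boussinesq.om * k ∈ Boussinesq.arc (Real.pi / 3) (2 * Real.pi / 3) := by
      convert Boussinesq.arc_sub_two_pi (Boussinesq.om_mul_mem_arc hk) using 1
      congr 1 <;> ring
    obtain ⟨hkQ, h0, h1, h2⟩ := Boussinesq.dChar_sign_of_mem_arc_third (Or.inl hk')
    obtain ⟨hw1, hfw⟩ := Boussinesq.bounds_of_third u₀ v₀ hkQ h0 h1 h2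
    have hf0 := Boussinesq.fReal_pos u₀ v₀ (Boussinesq.om * k)
    rw [Boussinesq.nuHat1, Boussinesq.nu3, Boussinesq.nu1, Boussinesq.one_add_r1_mul_r2 u₀ v₀ hkQ, Boussinesq.f_eq u₀ v₀ hkQ, Boussinesq.nuLog_ofReal hf0,
      Boussinesq.nuLog_ofReal (hf0.trans_le hfw), ← Complex.ofReal_sub, ← mul_sub]
    refine Complex.zero_le_real.2 (mul_nonneg_of_nonpos_of_nonpos ?_
      (sub_nonpos.2 (Real.log_le_log hf0 hfw)))
    exact neg_nonpos.2 (by positivity)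
  · intro k hk
    -- Put q = ωk and p = ω²k, so that q = ω²p. Then ν̂₂ = −(1/2π) ln(w(p) f(q) / f(p)) with w = 1 +
    -- r₁r₂. At p the exponent l₃ is in the middle, at q it is l₁, so f(q) ≤ 1.
    have hq : Boussinesq.om * k ∈ Boussinesq.arc (5 * Real.pi / 3) (2 * Real.pi) := by
      convert Boussinesq.om_mul_mem_arc hk using 1
      congr 1 <;> ring
    have hp : Boussinesq.om ^ 2 * k ∈ Boussinesq.arc (Real.pi / 3) (2 * Real.pi / 3) := by
      rw [sq, mul_assoc]
      convert Boussinesq.arc_sub_two_pi (Boussinesq.om_mul_mem_arc hq) using 1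
      congr 1 <;> ring
    have hpq : Boussinesq.om ^ 2 * (Boussinesq.om ^ 2 * k) = Boussinesq.om * k := by
      rw [← mul_assoc, ← pow_add, show 2 + 2 = 3 + 1 from rfl, pow_succ, Boussinesq.om_pow_three, one_mul]
    obtain ⟨hqQ, a0, a1, a2⟩ := Boussinesq.dChar_sign_of_mem_arc_first (Or.inr hq)
    obtain ⟨hpQ, b0, b1, b2⟩ := Boussinesq.dChar_sign_of_mem_arc_third (Or.inl hp)
    have hfq := (Boussinesq.bounds_of_first u₀ v₀ hqQ a0 a1 a2).2.2
    have hwp := one_pos.trans_le (Boussinesq.bounds_of_third u₀ v₀ hpQ b0 b1 b2).1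
    have hle := Boussinesq.wReal_mul_fReal_le u₀ v₀ hpQ b0 b1 b2 (by rwa [hpq])
    rw [hpq] at hle
    have hf0 := Boussinesq.fReal_pos u₀ v₀ (Boussinesq.om * k)
    have hf1 := Boussinesq.fReal_pos u₀ v₀ (Boussinesq.om ^ 2 * k)
    have hlog := Real.log_le_log (mul_pos hwp hf0) hle
    rw [Real.log_mul hwp.ne' hf0.ne'] at hlog
    rw [Boussinesq.nuHat2, Boussinesq.nu2, Boussinesq.nu3, Boussinesq.nu4, Boussinesq.one_add_r1_mul_r2 u₀ v₀ hpQ, Boussinesq.f_eq u₀ v₀ hqQ, Boussinesq.f_eq u₀ v₀ hpQ,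
      Boussinesq.nuLog_ofReal hf0, Boussinesq.nuLog_ofReal hf1, Boussinesq.nuLog_ofReal hwp, ← Complex.ofReal_add,
      ← Complex.ofReal_sub, ← mul_add, ← mul_sub]
    refine Complex.zero_le_real.2 (mul_nonneg_of_nonpos_of_nonpos ?_ (by linarith))
    exact neg_nonpos.2 (by positivity)
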